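/- Let $\mathbf{CP}$ be the compact closed symmetric monoidal category whose objects are finite-dimensional Hilbert spaces (presented as $\mathbb{C}^{a}$ for a finite set $a$) and whose morphisms $A\to B$ are the completely positive maps $\mathcal L(A)\to\mathcal L(B)$, with cup and cap given by the (unnormalised) Bell state and effect, and let $\mathbf{QC}\subseteq\mathbf{CP}$ be the symmetric monoidal subcategory of trace-preserving maps (quantum channels). An *extension set* for $K\subseteq\mathbf{QC}(A,A')$ is a family $K_{X,X'}\subseteq\mathbf{QC}(A\otimes X,A'\otimes X')$ with $K_{I,I}=K$ such that for all $\phi\in K_{X,X'}$, $f:Y\to X\otimes E$ and $g:X'\otimes E\to Y'$ in $\mathbf{QC}$, the channel $f\cdot\phi\cdot g:=(\mathrm{id}_{A'}\otimes g)\circ(\phi\otimes \mathrm{id}_E)\circ(\mathrm{id}_A\otimes f)$ lies in $K_{Y,Y'}$. The *dilation extension* $\mathrm{dExt}_{X,X'}(K)$ is the set of those $\Phi\in\mathbf{QC}(A\otimes X,A'\otimes X')$ such that $(\mathrm{id}_{A'}\otimes\sigma)\circ\Phi\circ(\mathrm{id}_A\otimes\rho)\in K$ for all $\rho:I\to X$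 and $\sigma:X'\to I$ in $\mathbf{QC}$; it is an extension set for $K$. A *locally-applicable transformation* $K_{-,=}\to M_{-,=}$, where $M\subseteq\mathbf{QC}(B,B')$, is a family of functions $S_{X,X'}:K_{X,X'}\to M_{X,X'}$ with $S_{Y,Y'}(f\cdot\phi\cdot g)=f\cdot S_{X,X'}(\phi)\cdot g$ for all $f,\phi,g$ as above. A *quantum supermap* ($\mathbf{CP}$-supermap on $\mathbf{QC}$) of type $K_{-,=}\to M_{-,=}$ is a morphism $S:A^*\otimes A'\to B^*\otimes B'$ of $\mathbf{CP}$ such that for all $X,X'$ and $\phi\in K_{X,X'}$ the map $S[\phi]:B\otimes X\to B'\otimes X'$ lies in $M_{X,X'}$; here $S[\phi]$ is obtained by bending the input $A$ of $\phi$ to an output $A^*$ with the cup, applying $S\otimes\mathrm{id}_{X'}$, and bending $B^*$ back to an input $B$ with the cap. With extension sets as objects and componentwise composition, respectively composition in $\mathbf{CP}$, these are the morphisms of categories $\mathbf{lot}[\mathbf{QC}]$ and $\mathbf{QS}$. A set $K\subseteq\mathbf{QC}(A,A')$ is *normal* if $\rho\circ d\in K$ for every effect $d:A\to I$ and every state $\rho:I\to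 A'$ of $\mathbf{QC}$. Let $\mathbf{QS}_{con}$ and $\mathbf{lot}[\mathbf{QC}]_{con}$ be the full subcategories on the objects $\mathrm{dExt}_{-,=}(K)$ with $K$ a normal convex set of channels. **Corollary.** The assignment $K_{-,=}\mapsto K_{-,=}$, $S\mapsto\big(\phi\mapsto S[\phi]\big)_{X,X'}$ sends quantum supermaps to locally-applicable transformations and is a functor $\mathcal F_{\mathbf{CP}}:\mathbf{QS}\to\mathbf{lot}[\mathbf{QC}]$. Its restriction $\mathbf{QS}_{con}\to\mathbf{lot}[\mathbf{QC}]_{con}$ is surjective on objects, full and faithful; in particular it is an equivalence of categories $\mathbf{QS}_{con}\cong\mathbf{lot}[\mathbf{QC}]_{con}$. -/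

import Mathlib

open CategoryTheory MonoidalCategory

namespace HigherOrder

/-! ### Extension sets and locally-applicable transformations on a monoidal category -/

section General

universe v u

variable {C : Type u} [Category.{v} C] [MonoidalCategory C]

/-- `insertAux f φ g` is the process `A ⊗ Y ⟶ A' ⊗ Y'` obtained from `φ : A ⊗ X ⟶ A' ⊗ X'` by
adding a side wire `E` and acting with `f : Y ⟶ X ⊗ E` before, and with `g : X' ⊗ E ⟶ Y'` after `φ`
on the auxiliary wires only. -/
def insertAux {A A' X X' Y Y' E : C} (f : Y ⟶ X ⊗ E) (φ : A ⊗ X ⟶ A' ⊗ X')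
    (g : X' ⊗ E ⟶ Y') : A ⊗ Y ⟶ A' ⊗ Y' :=
  A ◁ f ≫ (α_ A X E).inv ≫ φ ▷ E ≫ (α_ A' X' E).hom ≫ A' ◁ g

/-- Insertion of a state and an effect into the auxiliary wires of `φ`. -/
def plug {A A' X X' : C} (ρ : 𝟙_ C ⟶ X) (φ : A ⊗ X ⟶ A' ⊗ X') (σ : X' ⟶ 𝟙_ C) : A ⟶ A' :=
  (ρ_ A).inv ≫ A ◁ ρ ≫ φ ≫ A' ◁ σ ≫ (ρ_ A').hom

/-- An extension set for `K ⊆ C(A, A')`: a family `K_{X,X'} ⊆ C(A ⊗ X, A' ⊗ X')` with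
`K_{I,I} = K`, stable under all actions on the auxiliary systems. -/
@[ext]
structure ExtensionSet {A A' : C} (K : Set (A ⟶ A')) where
  /-- the set `K_{X,X'}` -/
  carrier (X X' : C) : Set (A ⊗ X ⟶ A' ⊗ X')
  mem_unit_iff (φ : A ⟶ A') :
    (ρ_ A).hom ≫ φ ≫ (ρ_ A').inv ∈ carrier (𝟙_ C) (𝟙_ C) ↔ φ ∈ K
  insertAux_mem {X X' Y Y' E : C} (f : Y ⟶ X ⊗ E) (g : X' ⊗ E ⟶ Y') {φ : A ⊗ X ⟶ A' ⊗ X'}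
    (hφ : φ ∈ carrier X X') : insertAux f φ g ∈ carrier Y Y'

/-- The dilation extension: all `Φ` whose reduction by every state and every effect lies in `K`. -/
def dExt {A A' : C} (K : Set (A ⟶ A')) (X X' : C) : Set (A ⊗ X ⟶ A' ⊗ X') :=
  {Φ | ∀ (ρ : 𝟙_ C ⟶ X) (σ : X' ⟶ 𝟙_ C), plug ρ Φ σ ∈ K}

lemma plug_unit (hC : Limits.IsTerminal (𝟙_ C)) {A A' : C} (φ : A ⟶ A')
    (ρ : 𝟙_ C ⟶ 𝟙_ C) (σ : 𝟙_ C ⟶ 𝟙_ C) :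
    plug ρ ((ρ_ A).hom ≫ φ ≫ (ρ_ A').inv) σ = φ := by
  obtain rfl : ρ = 𝟙 _ := hC.hom_ext _ _
  obtain rfl : σ = 𝟙 _ := hC.hom_ext _ _
  simp [plug]

lemma plug_insertAux (hC : Limits.IsTerminal (𝟙_ C)) {A A' X X' Y Y' E : C} (f : Y ⟶ X ⊗ E)
    (φ : A ⊗ X ⟶ A' ⊗ X') (g : X' ⊗ E ⟶ Y') (ρ : 𝟙_ C ⟶ Y) (σ : Y' ⟶ 𝟙_ C) :
    plug ρ (insertAux f φ g) σ =
      plug (ρ ≫ f ≫ X ◁ hC.from E ≫ (ρ_ X).hom) φ (hC.from X') := by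
  have h : g ≫ σ = X' ◁ hC.from E ≫ (ρ_ X').hom ≫ hC.from X' := hC.hom_ext _ _
  have h2 : A' ◁ g ≫ A' ◁ σ = A' ◁ X' ◁ hC.from E ≫ A' ◁ (ρ_ X').hom ≫ A' ◁ hC.from X' := by
    simp only [← whiskerLeft_comp, h]
  have h3 : φ ▷ E ≫ (α_ A' X' E).hom ≫ A' ◁ X' ◁ hC.from E ≫ A' ◁ (ρ_ X').hom =
      (α_ A X E).hom ≫ A ◁ X ◁ hC.from E ≫ A ◁ (ρ_ X).hom ≫ φ := by
    calc
      _ = (φ ▷ E ≫ (A' ⊗ X') ◁ hC.from E) ≫ (ρ_ (A' ⊗ X')).hom := by monoidal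
      _ = _ := by rw [← whisker_exchange]; monoidal
  simp only [plug, insertAux, Category.assoc, whiskerLeft_comp]
  rw [reassoc_of% h2, reassoc_of% h3]
  simp

/-- If the unit object is terminal, the dilation extension is an extension set. -/
def ExtensionSet.dilation (hC : Limits.IsTerminal (𝟙_ C)) {A A' : C} (K : Set (A ⟶ A')) :
    ExtensionSet K where
  carrier := dExt K
  mem_unit_iff φ := by
    constructor
    · intro h
      have := h (𝟙 _) (𝟙 _)
      rwa [plug_unit hC] at this
    · intro h ρ σ
      rwa [plug_unit hC]
  insertAux_mem f g φ hφ ρ σ := by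
    rw [plug_insertAux hC]
    exact hφ _ _

/-- A set of processes is normal if it contains all discard-and-prepare processes: an effect
followed by a state. -/
def IsNormal {A A' : C} (K : Set (A ⟶ A')) : Prop :=
  ∀ (d : A ⟶ 𝟙_ C) (ρ : 𝟙_ C ⟶ A'), d ≫ ρ ∈ K

variable (C) in
/-- The objects between which supermaps and locally-applicable transformations go: sets
`K ⊆ C(A, A')` together with an extension set for `K`. -/
structure ExtObj where
  /-- the input system -/
  A : C
  /-- the output system -/
  A' : C
  /-- the set of processes -/
  K : Set (A ⟶ A')
  /-- the extension set -/
  ext : ExtensionSet K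

/-- A locally-applicable transformation `K_{-,=} ⟶ M_{-,=}`: functions `K_{X,X'} → M_{X,X'}`
which commute with all actions on the auxiliary systems. -/
@[ext]
structure LocallyApplicable (K M : ExtObj C) where
  /-- the function `S_{X,X'}` -/
  app (X X' : C) : K.ext.carrier X X' → M.ext.carrier X X'
  app_insertAux {X X' Y Y' E : C} (f : Y ⟶ X ⊗ E) (g : X' ⊗ E ⟶ Y') (φ : K.ext.carrier X X') :
    (app Y Y' ⟨insertAux f φ.1 g, K.ext.insertAux_mem f g φ.2⟩ : M.A ⊗ Y ⟶ M.A' ⊗ Y') =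
      insertAux f (app X X' φ).1 g

variable (C) in
/-- The category of locally-applicable transformations on `C`. -/
structure Lot where
  /-- the underlying object -/
  of : ExtObj C

instance : Category (Lot C) where
  Hom K M := LocallyApplicable K.of M.of
  id K := ⟨fun _ _ φ => φ, fun _ _ _ => rfl⟩
  comp S T := ⟨fun X X' φ => T.app X X' (S.app X X' φ), fun f g φ => by
    rw [← T.app_insertAux]
    congr 2
    exact Subtype.ext (S.app_insertAux f g φ)⟩

end General

/-! ### `P`-supermaps on a wide monoidal subcategory `C` of a compact closed category `P` -/

section Supermap

universe v u

variable {P : Type u} [Category.{v} P] [MonoidalCategory P] [LeftRigidCategory P]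

/-- The action of `S : A* ⊗ A' ⟶ B* ⊗ B'` on the `A, A'` part of `φ : A ⊗ X ⟶ A' ⊗ X'`: bend the
input wire `A` of `φ` to an output wire `A*` with the cup, apply `S` next to `X'`, and bend the
output wire `B*` back to an input wire `B` with the cap. -/
def act {A A' B B' : P} (S : (ᘁA : P) ⊗ A' ⟶ (ᘁB : P) ⊗ B') {X X' : P}
    (φ : A ⊗ X ⟶ A' ⊗ X') : B ⊗ X ⟶ B' ⊗ X' :=
  (tensorLeftHomEquiv X (ᘁB) B (B' ⊗ X')).symm
    (tensorLeftHomEquiv X (ᘁA) A (A' ⊗ X') φ ≫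
      (α_ (ᘁA) A' X').inv ≫ S ▷ X' ≫ (α_ (ᘁB) B' X').hom)

lemma act_id {A A' X X' : P} (φ : A ⊗ X ⟶ A' ⊗ X') :
    act (𝟙 ((ᘁA : P) ⊗ A')) φ = φ := by
  simp [act]

lemma act_comp {A A' B B' D D' X X' : P} (S : (ᘁA : P) ⊗ A' ⟶ (ᘁB : P) ⊗ B')
    (T : (ᘁB : P) ⊗ B' ⟶ (ᘁD : P) ⊗ D') (φ : A ⊗ X ⟶ A' ⊗ X') :
    act (S ≫ T) φ = act T (act S φ) := by
  simp [act]

lemma bend_insertAux {A A' X X' Y Y' E : P} (f : Y ⟶ X ⊗ E) (φ : A ⊗ X ⟶ A' ⊗ X')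
    (g : X' ⊗ E ⟶ Y') :
    tensorLeftHomEquiv Y (ᘁA) A (A' ⊗ Y') (insertAux f φ g) =
      f ≫ (tensorLeftHomEquiv X (ᘁA) A (A' ⊗ X') φ) ▷ E ≫ (α_ _ _ _).hom ≫
        (ᘁA) ◁ ((α_ _ _ _).hom ≫ A' ◁ g) := by
  rw [← Equiv.eq_symm_apply, tensorLeftHomEquiv_symm_naturality]
  simp only [insertAux]
  congr 1
  rw [Equiv.eq_symm_apply]
  simp only [← Category.assoc, tensorLeftHomEquiv_naturality]
  simp [tensorLeftHomEquiv]

lemma act_insertAux {A A' B B' : P} (S : (ᘁA : P) ⊗ A' ⟶ (ᘁB : P) ⊗ B') {X X' Y Y' E : P}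
    (f : Y ⟶ X ⊗ E) (φ : A ⊗ X ⟶ A' ⊗ X') (g : X' ⊗ E ⟶ Y') :
    act S (insertAux f φ g) = insertAux f (act S φ) g := by
  rw [act, Equiv.symm_apply_eq, bend_insertAux, bend_insertAux, act, Equiv.apply_symm_apply]
  have h : (ᘁA : P) ◁ A' ◁ g ≫ (α_ (ᘁA : P) A' Y').inv ≫ S ▷ Y' ≫ (α_ (ᘁB : P) B' Y').hom =
      (α_ (ᘁA : P) A' (X' ⊗ E)).inv ≫ S ▷ (X' ⊗ E) ≫ (α_ (ᘁB : P) B' (X' ⊗ E)).hom ≫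
        (ᘁB : P) ◁ B' ◁ g := by
    calc
      _ = 𝟙 _ ⊗≫ (((ᘁA : P) ⊗ A') ◁ g ≫ S ▷ Y') ⊗≫ 𝟙 _ := by monoidal
      _ = _ := by rw [whisker_exchange]; monoidal
  simp only [comp_whiskerRight, Category.assoc, whiskerLeft_comp, h]
  monoidal

variable (W : MorphismProperty P) [W.IsMonoidalStable]

/-- A `P`-supermap on `C` of type `K_{-,=} ⟶ M_{-,=}`, where `C` is the wide subcategory of `P` on
the morphisms in `W`: a morphism `A* ⊗ A' ⟶ B* ⊗ B'` of `P` that sends `K_{X,X'}` to `M_{X,X'}`. -/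
@[ext]
structure Supermap (K M : ExtObj (WideSubcategory W)) where
  /-- the underlying morphism of `P` -/
  hom : (ᘁK.A.obj : P) ⊗ K.A'.obj ⟶ (ᘁM.A.obj : P) ⊗ M.A'.obj
  act_mem {X X' : WideSubcategory W} (φ : K.A ⊗ X ⟶ K.A' ⊗ X') (hφ : φ ∈ K.ext.carrier X X') :
    ∃ h : W (act hom φ.hom), (⟨act hom φ.hom, h⟩ : M.A ⊗ X ⟶ M.A' ⊗ X') ∈ M.ext.carrier X X'

/-- The category of `P`-supermaps on `C`. -/
structure Psup where
  /-- the underlying object -/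
  of : ExtObj (WideSubcategory W)

instance : Category (Psup W) where
  Hom K M := Supermap W K.of M.of
  id K := ⟨𝟙 _, fun φ hφ => by
    simp only [act_id]
    exact ⟨φ.property, hφ⟩⟩
  comp S T := ⟨S.hom ≫ T.hom, fun φ hφ => by
    simp only [act_comp]
    obtain ⟨h, hψ⟩ := S.act_mem φ hφ
    exact T.act_mem _ hψ⟩

/-- The functor from `P`-supermaps on `C` to locally-applicable transformations on `C`: it is the
identity on objects, and sends a supermap `S` to the family of functions `φ ↦ act S φ`. -/
def supermapToLot : Psup W ⥤ Lot (WideSubcategory W) where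
  obj K := ⟨K.of⟩
  map S :=
    { app := fun X X' φ => ⟨⟨act S.hom φ.1.hom, (S.act_mem φ.1 φ.2).fst⟩, (S.act_mem φ.1 φ.2).snd⟩
      app_insertAux := fun f g φ => WideSubcategory.hom_ext _ (act_insertAux _ _ _ _) }
  map_id K := by
    refine LocallyApplicable.ext ?_
    funext X X' φ
    exact Subtype.ext (WideSubcategory.hom_ext _ (act_id _))
  map_comp S T := by
    refine LocallyApplicable.ext ?_
    funext X X' φ
    exact Subtype.ext (WideSubcategory.hom_ext _ (act_comp _ _ _))

end Supermap

/-! ### Completely positive maps and quantum channels -/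

section Quantum

open Matrix Kronecker ComplexOrder

/-- A finite-dimensional quantum system, presented by a finite orthonormal basis `idx` of its
Hilbert space `ℂ^idx`. Its operators are the matrices indexed by `idx`. -/
structure CP : Type 1 where
  /-- the index set of the basis -/
  idx : Type
  [fintype : Fintype idx]
  [decEq : DecidableEq idx]

attribute [instance] CP.fintype CP.decEq

/-- `Φ ⊗ id` on matrices over a product. -/
def ampRight {a b : Type} (Φ : Matrix a a ℂ →ₗ[ℂ] Matrix b b ℂ) (c : Type) :
    Matrix (a × c) (a × c) ℂ →ₗ[ℂ] Matrix (b × c) (b × c) ℂ where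
  toFun X := of fun p q => Φ (of fun i j => X (i, p.2) (j, q.2)) p.1 q.1
  map_add' X Y := by
    ext p q
    exact congrFun (congrFun (map_add Φ (of fun i j => X (i, p.2) (j, q.2))
      (of fun i j => Y (i, p.2) (j, q.2))) p.1) q.1
  map_smul' r X := by
    ext p q
    exact congrFun (congrFun (map_smul Φ r (of fun i j => X (i, p.2) (j, q.2))) p.1) q.1

/-- `id ⊗ Φ` on matrices over a product. -/
def ampLeft {a b : Type} (c : Type) (Φ : Matrix a a ℂ →ₗ[ℂ] Matrix b b ℂ) :
    Matrix (c × a) (c × a) ℂ →ₗ[ℂ] Matrix (c × b) (c × b) ℂ where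
  toFun X := of fun p q => Φ (of fun i j => X (p.1, i) (q.1, j)) p.2 q.2
  map_add' X Y := by
    ext p q
    exact congrFun (congrFun (map_add Φ (of fun i j => X (p.1, i) (q.1, j))
      (of fun i j => Y (p.1, i) (q.1, j))) p.2) q.2
  map_smul' r X := by
    ext p q
    exact congrFun (congrFun (map_smul Φ r (of fun i j => X (p.1, i) (q.1, j))) p.2) q.2

/-- Complete positivity: `Φ ⊗ id` preserves positive semidefinite matrices, for every finite
ancilla. -/
def IsCompletelyPositive {a b : Type} (Φ : Matrix a a ℂ →ₗ[ℂ] Matrix b b ℂ) : Prop :=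
  ∀ (c : Type) [Fintype c] (X : Matrix (a × c) (a × c) ℂ), X.PosSemidef →
    (ampRight Φ c X).PosSemidef

/-- Relabelling of the basis. -/
def relabel {a b : Type} (e : a ≃ b) : Matrix a a ℂ →ₗ[ℂ] Matrix b b ℂ :=
  (reindexLinearEquiv ℂ ℂ e e).toLinearMap

/-- Conjugation `X ↦ V X Vᴴ`. -/
def conj {a b : Type} [Fintype a] (V : Matrix b a ℂ) : Matrix a a ℂ →ₗ[ℂ] Matrix b b ℂ where
  toFun X := V * X * Vᴴ
  map_add' X Y := by simp [Matrix.mul_add, Matrix.add_mul]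
  map_smul' r X := by simp

section lemmas

variable {a b c d : Type}

@[simp] lemma ampRight_apply (Φ : Matrix a a ℂ →ₗ[ℂ] Matrix b b ℂ) (X : Matrix (a × c) (a × c) ℂ)
    (p q : b × c) : ampRight Φ c X p q = Φ (of fun i j => X (i, p.2) (j, q.2)) p.1 q.1 := rfl

@[simp] lemma ampLeft_apply (Φ : Matrix a a ℂ →ₗ[ℂ] Matrix b b ℂ) (X : Matrix (c × a) (c × a) ℂ)
    (p q : c × b) : ampLeft c Φ X p q = Φ (of fun i j => X (p.1, i) (q.1, j)) p.2 q.2 := rfl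

@[simp] lemma relabel_apply (e : a ≃ b) (X : Matrix a a ℂ) (i j : b) :
    relabel e X i j = X (e.symm i) (e.symm j) := rfl

lemma ampRight_kronecker (Φ : Matrix a a ℂ →ₗ[ℂ] Matrix b b ℂ) (X : Matrix a a ℂ)
    (Y : Matrix c c ℂ) : ampRight Φ c (X ⊗ₖ Y) = Φ X ⊗ₖ Y := by
  ext p q
  have : (of fun i j => (X ⊗ₖ Y) (i, p.2) (j, q.2)) = Y p.2 q.2 • X := by
    ext i j
    simp [mul_comm]
  rw [ampRight_apply, this]
  simp [mul_comm]

lemma ampLeft_kronecker (Φ : Matrix a a ℂ →ₗ[ℂ] Matrix b b ℂ) (X : Matrix a a ℂ)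
    (Y : Matrix c c ℂ) : ampLeft c Φ (Y ⊗ₖ X) = Y ⊗ₖ Φ X := by
  ext p q
  have : (of fun i j => (Y ⊗ₖ X) (p.1, i) (q.1, j)) = Y p.1 q.1 • X := by
    ext i j
    simp
  rw [ampLeft_apply, this]
  simp

/-- Operations on different tensor factors commute. -/
lemma amp_exchange [Finite a] [Finite c] (Φ : Matrix a a ℂ →ₗ[ℂ] Matrix b b ℂ)
    (Ψ : Matrix c c ℂ →ₗ[ℂ] Matrix d d ℂ) :
    ampLeft b Ψ ∘ₗ ampRight Φ c = ampRight Φ d ∘ₗ ampLeft a Ψ := by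
  classical
  have := Fintype.ofFinite a
  have := Fintype.ofFinite c
  refine Matrix.ext_linearMap _ fun p q => ?_
  refine LinearMap.ext_ring ?_
  have h : single p q (1 : ℂ) = single p.1 q.1 (1 : ℂ) ⊗ₖ single p.2 q.2 (1 : ℂ) := by
    rw [single_kronecker_single, one_mul]
  simp only [LinearMap.comp_apply, singleLinearMap_apply, h, ampRight_kronecker, ampLeft_kronecker]

lemma ampRight_comp (Φ : Matrix a a ℂ →ₗ[ℂ] Matrix b b ℂ) (Ψ : Matrix b b ℂ →ₗ[ℂ] Matrix d d ℂ) :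
    ampRight (Ψ ∘ₗ Φ) c = ampRight Ψ c ∘ₗ ampRight Φ c := rfl

lemma ampLeft_comp (Φ : Matrix a a ℂ →ₗ[ℂ] Matrix b b ℂ) (Ψ : Matrix b b ℂ →ₗ[ℂ] Matrix d d ℂ) :
    ampLeft c (Ψ ∘ₗ Φ) = ampLeft c Ψ ∘ₗ ampLeft c Φ := rfl

lemma IsCompletelyPositive.id : IsCompletelyPositive (LinearMap.id (R := ℂ) (M := Matrix a a ℂ)) :=
  fun _ _ _ hX => hX

lemma IsCompletelyPositive.comp {Φ : Matrix a a ℂ →ₗ[ℂ] Matrix b b ℂ}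
    {Ψ : Matrix b b ℂ →ₗ[ℂ] Matrix d d ℂ} (hΨ : IsCompletelyPositive Ψ)
    (hΦ : IsCompletelyPositive Φ) : IsCompletelyPositive (Ψ ∘ₗ Φ) :=
  fun c _ X hX => hΨ c _ (hΦ c X hX)

lemma IsCompletelyPositive.relabel (e : a ≃ b) : IsCompletelyPositive (relabel e) :=
  fun c _ _ hX => hX.submatrix (Prod.map e.symm (_root_.id : c → c))

lemma IsCompletelyPositive.ampRight {Φ : Matrix a a ℂ →ₗ[ℂ] Matrix b b ℂ}
    (hΦ : IsCompletelyPositive Φ) (c : Type) [Fintype c] :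
    IsCompletelyPositive (ampRight Φ c) := fun d _ _ hX =>
  (hΦ (c × d) _ (hX.submatrix (Equiv.prodAssoc a c d).symm)).submatrix (Equiv.prodAssoc b c d)

lemma IsCompletelyPositive.ampLeft {Φ : Matrix a a ℂ →ₗ[ℂ] Matrix b b ℂ}
    (hΦ : IsCompletelyPositive Φ) (c : Type) [Fintype c] :
    IsCompletelyPositive (ampLeft c Φ) :=
  (IsCompletelyPositive.relabel (Equiv.prodComm b c)).comp
    ((hΦ.ampRight c).comp (IsCompletelyPositive.relabel (Equiv.prodComm c a)))

lemma IsCompletelyPositive.conj [Fintype a] [Finite b] (V : Matrix b a ℂ) :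
    IsCompletelyPositive (conj V) := by
  classical
  intro c _ _ hX
  have := Fintype.ofFinite b
  convert hX.mul_mul_conjTranspose_same (V ⊗ₖ (1 : Matrix c c ℂ)) using 1
  ext p q
  simp [HigherOrder.conj, Matrix.mul_apply, Fintype.sum_prod_type, Matrix.one_apply,
    apply_ite (starRingEnd ℂ)]

/-- The trace, valued in `1 × 1` matrices. -/
def traceMap (a : Type) [Fintype a] : Matrix a a ℂ →ₗ[ℂ] Matrix Unit Unit ℂ where
  toFun X := of fun _ _ => X.trace
  map_add' X Y := by ext; simp
  map_smul' r X := by ext; simp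

lemma isCompletelyPositive_traceMap [Fintype a] : IsCompletelyPositive (traceMap a) := by
  intro c _ X hX
  have h := posSemidef_sum Finset.univ (fun (i : a) _ =>
    hX.submatrix (fun p : Unit × c => (i, p.2)))
  convert h using 1
  ext p q
  simp [Matrix.sum_apply, Matrix.trace, traceMap]

end lemmas

namespace CP

/-- A morphism of `CP`: a completely positive linear map between operator spaces. -/
@[ext]
structure Hom (A B : CP) where
  /-- the underlying linear map -/
  lin : Matrix A.idx A.idx ℂ →ₗ[ℂ] Matrix B.idx B.idx ℂ
  isCP : IsCompletelyPositive lin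

instance : Category CP where
  Hom := Hom
  id A := ⟨LinearMap.id, .id⟩
  comp f g := ⟨g.lin ∘ₗ f.lin, g.isCP.comp f.isCP⟩

lemma hom_ext {A B : CP} {f g : A ⟶ B} (h : ∀ X i j, f.lin X i j = g.lin X i j) : f = g :=
  Hom.ext (LinearMap.ext fun X => Matrix.ext fun i j => h X i j)

@[simp] lemma id_lin (A : CP) : Hom.lin (𝟙 A) = LinearMap.id := rfl

@[simp] lemma comp_lin {A B D : CP} (f : A ⟶ B) (g : B ⟶ D) :
    (f ≫ g).lin = g.lin ∘ₗ f.lin := rfl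

/-- The isomorphism of systems given by a bijection of basis labels. -/
@[simps]
def isoOfEquiv {A B : CP} (e : A.idx ≃ B.idx) : A ≅ B where
  hom := ⟨relabel e, .relabel e⟩
  inv := ⟨relabel e.symm, .relabel e.symm⟩
  hom_inv_id := hom_ext fun X i j => by simp
  inv_hom_id := hom_ext fun X i j => by simp

@[simps]
instance : MonoidalCategoryStruct CP where
  tensorObj A B := ⟨A.idx × B.idx⟩
  whiskerLeft A _ _ f := ⟨ampLeft A.idx f.lin, f.isCP.ampLeft _⟩
  whiskerRight f B := ⟨ampRight f.lin B.idx, f.isCP.ampRight _⟩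
  tensorUnit := ⟨Unit⟩
  associator A B D := isoOfEquiv (Equiv.prodAssoc A.idx B.idx D.idx)
  leftUnitor A := isoOfEquiv (Equiv.punitProd A.idx)
  rightUnitor A := isoOfEquiv (Equiv.prodPUnit A.idx)

lemma exchange {A B D E : CP} (f : A ⟶ B) (g : D ⟶ E) :
    f ▷ D ≫ B ◁ g = A ◁ g ≫ f ▷ E :=
  Hom.ext (amp_exchange f.lin g.lin)

instance : MonoidalCategory CP where
  id_tensorHom_id _ _ := rfl
  tensorHom_comp_tensorHom {X₁ Y₁ Z₁ X₂ Y₂ Z₂} f₁ f₂ g₁ g₂ := by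
    change (f₁ ▷ X₂ ≫ Y₁ ◁ f₂) ≫ (g₁ ▷ Y₂ ≫ Z₁ ◁ g₂) = (f₁ ≫ g₁) ▷ X₂ ≫ Z₁ ◁ (f₂ ≫ g₂)
    have h := exchange g₁ f₂
    calc
      _ = f₁ ▷ X₂ ≫ (Y₁ ◁ f₂ ≫ g₁ ▷ Y₂) ≫ Z₁ ◁ g₂ := by simp only [Category.assoc]
      _ = (f₁ ▷ X₂ ≫ g₁ ▷ X₂) ≫ (Z₁ ◁ f₂ ≫ Z₁ ◁ g₂) := by
        rw [← h]; simp only [Category.assoc]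
      _ = _ := rfl
  whiskerLeft_id _ _ := rfl
  id_whiskerRight _ _ := rfl
  associator_naturality _ _ _ := rfl
  leftUnitor_naturality _ := rfl
  rightUnitor_naturality _ := rfl
  pentagon _ _ _ _ := rfl
  triangle _ _ := rfl

instance : SymmetricCategory CP where
  braiding A B := isoOfEquiv (Equiv.prodComm A.idx B.idx)
  braiding_naturality_right _ _ _ _ := rfl
  braiding_naturality_left _ _ := rfl
  hexagon_forward _ _ _ := rfl
  hexagon_reverse _ _ _ := rfl
  symmetry _ _ := rfl

/-- The unnormalised Bell vector `∑ i, e_i ⊗ e_i`, as a column. -/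
def bell (a : Type) [DecidableEq a] : Matrix (a × a) Unit ℂ :=
  of fun p _ => if p.1 = p.2 then 1 else 0

/-- `CP` is compact closed. The dual of `ℂ^a` is identified with `ℂ^a` through the dual basis, the
cup is the (unnormalised) Bell state and the cap is the (unnormalised) Bell effect. -/
instance : LeftRigidCategory CP where
  leftDual A :=
    { leftDual := A
      exact :=
        { coevaluation' := ⟨conj (bell A.idx), .conj _⟩
          evaluation' := ⟨conj (bell A.idx)ᴴ, .conj _⟩
          coevaluation_evaluation' := hom_ext fun X i j => by
            simp [conj, bell, Matrix.mul_apply, Fintype.sum_prod_type]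
          evaluation_coevaluation' := hom_ext fun X i j => by
            simp [conj, bell, Matrix.mul_apply, Fintype.sum_prod_type] } }

/-- The trace-preserving completely positive maps. -/
def tracePreserving : MorphismProperty CP :=
  fun _ _ f => ∀ X, (f.lin X).trace = X.trace

lemma relabel_trace {a b : Type} [Fintype a] [Fintype b] (e : a ≃ b) (X : Matrix a a ℂ) :
    (relabel e X).trace = X.trace :=
  Equiv.sum_comp e.symm fun i => X i i

instance : tracePreserving.IsMultiplicative where
  id_mem _ _ := rfl
  comp_mem _ _ hf hg X := (hg _).trans (hf X)

instance : tracePreserving.IsMonoidalStable where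
  whiskerLeft A B D f hf X := by
    change ∑ p : A.idx × D.idx, f.lin (of fun i j => X (p.1, i) (p.1, j)) p.2 p.2 =
      ∑ p : A.idx × B.idx, X p p
    rw [Fintype.sum_prod_type, Fintype.sum_prod_type]
    exact Finset.sum_congr rfl fun k _ => hf (of fun i j => X (k, i) (k, j))
  whiskerRight {A D} f hf B X := by
    change ∑ p : D.idx × B.idx, f.lin (of fun i j => X (i, p.2) (j, p.2)) p.1 p.1 =
      ∑ p : A.idx × B.idx, X p p
    rw [Fintype.sum_prod_type_right, Fintype.sum_prod_type_right]
    exact Finset.sum_congr rfl fun k _ => hf (of fun i j => X (i, k) (j, k))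
  associator_hom_mem _ _ _ := relabel_trace _
  associator_inv_mem _ _ _ := relabel_trace _
  leftUnitor_hom_mem _ := relabel_trace _
  leftUnitor_inv_mem _ := relabel_trace _
  rightUnitor_hom_mem _ := relabel_trace _
  rightUnitor_inv_mem _ := relabel_trace _

instance : tracePreserving.IsStableUnderBraiding where
  braiding_hom_mem _ _ := relabel_trace _
  braiding_inv_mem _ _ := relabel_trace _

end CP

/-- The symmetric monoidal category `QC` of quantum channels: the completely positive
trace-preserving maps. -/
abbrev QC := WideSubcategory CP.tracePreserving

/-- The trace, as a quantum channel to the unit object. -/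
def discard (A : QC) : A ⟶ 𝟙_ QC where
  hom := ⟨traceMap A.obj.idx, isCompletelyPositive_traceMap⟩
  property X := by
    change ∑ _i : Unit, X.trace = X.trace
    simp

/-- `QC` is causal: its unit object is terminal. -/
def isTerminalUnit : Limits.IsTerminal (𝟙_ QC) :=
  Limits.IsTerminal.ofUniqueHom discard fun A f => by
    refine WideSubcategory.hom_ext _ (CP.hom_ext fun X i j => ?_)
    have h : ∑ k : Unit, f.hom.lin X k k = X.trace := f.property X
    have h' : f.hom.lin X () () = X.trace := by simpa using h
    exact h'

/-- A set of quantum channels is convex if it is closed under convex combinations, these being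
formed in the space of linear maps. -/
def IsConvex {A A' : QC} (K : Set (A ⟶ A')) : Prop :=
  Convex ℝ ((fun φ : A ⟶ A' => φ.hom.lin) '' K)

/-- The objects `dExt(K)` for `K` a normal convex set of quantum channels. -/
def IsNormalConvex (K : ExtObj QC) : Prop :=
  IsConvex K.K ∧ IsNormal K.K ∧ K.ext = ExtensionSet.dilation isTerminalUnit K.K

/-- The category of quantum supermaps, i.e. `CP`-supermaps on `QC`. -/
abbrev QS := Psup CP.tracePreserving

/-- The functor from quantum supermaps to locally-applicable transformations on `QC`. -/
abbrev FCP : QS ⥤ Lot QC := supermapToLot CP.tracePreserving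

/-- The full subcategory of quantum supermaps between normal convex sets. -/
abbrev QScon := ObjectProperty.FullSubcategory fun K : QS => IsNormalConvex K.of

/-- The full subcategory of locally-applicable transformations on `QC` between normal convex
sets. -/
abbrev LotCon := ObjectProperty.FullSubcategory fun K : Lot QC => IsNormalConvex K.of

/-- The restriction of `FCP` to normal convex sets. -/
abbrev FCPcon : QScon ⥤ LotCon :=
  ObjectProperty.lift _ (ObjectProperty.ι _ ⋙ FCP) fun K => K.property

end Quantum

end HigherOrder

/-!
Faithfulness. If `K` is normal, the swap `A ⊗ A' ⟶ A' ⊗ A` lies in `dExt(K)`, because all its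
reductions discard the input and prepare a state (`QC.braiding_mem_dExt`). The action of a supermap
on the swap is the supermap itself with two wires bent, so it determines the supermap
(`act_braiding_injective`).

Fullness. Given a locally-applicable transformation `S`, unbending the wires of `S(swap)` gives a
completely positive map `S'` with `act S' swap = S(swap)` (`act_unbraid`). In the compact closed
category every `φ` is an insertion of the swap between a cup and a cap, which are not channels.
Replace the cup by a normalised Bell pair, and the cap by a Bell measurement whose outcome is
recorded in a classical bit. The resulting channel `ψ` (`QC.simulate`) is an insertion of the swap by
channels, and its part with outcome true is `t φ`, where `t = 1 / dim(A')²`. As `act S'` commutes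
with all insertions in `CP`, the true part of `S(ψ)` is `t • act S' φ`.

It remains to see that the true part of `S(ψ)` is also `t • S(φ)`, although the other part of `ψ` need
not be a multiple of an element of `dExt(K)`. Convexity of `K` makes `dExt(K)` closed under control by
a bit, so `S` preserves equal mixtures (`LocallyApplicable.tensorLin_add_eq`). The sum of `ψ` and of
`φ` with the bit false equals the sum of `ψ` with its bit reset to false and of `φ` with the bit true
with probability `t` (`QC.tensorLin_add_eq_of_block`). Applying `S` and comparing the parts where the
bit is true gives the claim.

The Bell pair needs `A'` to have positive dimension. If it has dimension zero, then all values of `S`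
have zero-dimensional input and there is nothing to compare
(`LocallyApplicable.isEmpty_of_isEmpty`).
-/

namespace HigherOrder

open CategoryTheory MonoidalCategory Matrix Kronecker ComplexOrder

/-! ### Supermaps in matrix entries -/

/-- The linear map of a morphism of `CP` between tensor products, on matrices over the product of
the two index sets. -/
def CP.tensorLin {A A' X X' : CP} (φ : A ⊗ X ⟶ A' ⊗ X') :
    Matrix (A.idx × X.idx) (A.idx × X.idx) ℂ →ₗ[ℂ] Matrix (A'.idx × X'.idx) (A'.idx × X'.idx) ℂ :=
  φ.lin

lemma CP.tensorLin_injective {A A' X X' : CP} {φ ψ : A ⊗ X ⟶ A' ⊗ X'}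
    (h : tensorLin φ = tensorLin ψ) : φ = ψ :=
  CP.Hom.ext h

/-- A linear map on matrices over a product is determined by its values on the products
`single b c 1 ⊗ₖ N`. -/
lemma linearMap_ext_single_kronecker {b x V : Type} [Fintype b] [DecidableEq b] [Finite x]
    [AddCommGroup V] [Module ℂ V] {Φ Ψ : Matrix (b × x) (b × x) ℂ →ₗ[ℂ] V}
    (h : ∀ i j (N : Matrix x x ℂ), Φ (single i j 1 ⊗ₖ N) = Ψ (single i j 1 ⊗ₖ N)) : Φ = Ψ := by
  classical
  have := Fintype.ofFinite x
  refine Matrix.ext_linearMap _ fun p q => LinearMap.ext_ring ?_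
  have h' : single p q (1 : ℂ) = single p.1 q.1 (1 : ℂ) ⊗ₖ single p.2 q.2 (1 : ℂ) := by
    rw [single_kronecker_single, one_mul]
  simp only [LinearMap.comp_apply, singleLinearMap_apply, h', h]

/-- Bending the input `A` of `φ` gives its partial Choi matrix. -/
lemma bend_lin {A A' X X' : CP} (φ : A ⊗ X ⟶ A' ⊗ X') (N : Matrix X.idx X.idx ℂ)
    (p q : A.idx × A'.idx × X'.idx) :
    CP.Hom.lin (tensorLeftHomEquiv X (ᘁA) A (A' ⊗ X') φ) N p q =
      CP.tensorLin φ (single p.1 q.1 (1 : ℂ) ⊗ₖ N) p.2 q.2 := by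
  change CP.tensorLin φ (of fun s t : A.idx × X.idx =>
    conj (CP.bell A.idx) (of fun _ _ : Unit => N s.2 t.2) (p.1, s.1) (q.1, t.1)) p.2 q.2 = _
  have h : (of fun s t : A.idx × X.idx => conj (CP.bell A.idx) (of fun _ _ : Unit => N s.2 t.2)
      (p.1, s.1) (q.1, t.1)) = single p.1 q.1 (1 : ℂ) ⊗ₖ N := by
    ext s t
    simp only [conj, CP.bell, LinearMap.coe_mk, AddHom.coe_mk, Matrix.mul_apply, of_apply,
      conjTranspose_apply, kroneckerMap_apply, single_apply, ite_and]
    split_ifs <;> simp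
  rw [h]

lemma unbend_lin {A A' X X' : CP} (φ : X ⟶ (ᘁA : CP) ⊗ (A' ⊗ X')) (b c : A.idx)
    (N : Matrix X.idx X.idx ℂ) (p q : A'.idx × X'.idx) :
    CP.tensorLin ((tensorLeftHomEquiv X (ᘁA) A (A' ⊗ X')).symm φ) (single b c (1 : ℂ) ⊗ₖ N) p q =
      CP.Hom.lin φ N (b, p) (c, q) := by
  change conj (CP.bell A.idx)ᴴ (of fun s t : A.idx × A.idx => φ.lin
    (of fun i j => (single b c (1 : ℂ) ⊗ₖ N) (s.1, i) (t.1, j)) (s.2, p) (t.2, q)) () () = _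
  have h (s t : A.idx × A.idx) : (of fun i j => (single b c (1 : ℂ) ⊗ₖ N) (s.1, i) (t.1, j)) =
      (if b = s.1 ∧ c = t.1 then (1 : ℂ) else 0) • N := by
    ext i j
    simp [single_apply]
  simp only [h, map_smul]
  simp [conj, CP.bell, Matrix.mul_apply, Fintype.sum_prod_type, ite_and]

/-- The action of `S` in matrix entries: `S` is applied to the partial Choi matrix of `φ`. -/
lemma act_lin {A A' B B' X X' : CP} (S : (ᘁA : CP) ⊗ A' ⟶ (ᘁB : CP) ⊗ B')
    (φ : A ⊗ X ⟶ A' ⊗ X') (b c : B.idx) (N : Matrix X.idx X.idx ℂ) (p q : B'.idx × X'.idx) :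
    CP.tensorLin (act S φ) (single b c (1 : ℂ) ⊗ₖ N) p q =
      CP.tensorLin S (of fun s t : A.idx × A'.idx =>
        CP.tensorLin φ (single s.1 t.1 (1 : ℂ) ⊗ₖ N) (s.2, p.2) (t.2, q.2)) (b, p.1) (c, q.1) := by
  rw [act, unbend_lin]
  change CP.tensorLin S (of fun s t : A.idx × A'.idx => CP.Hom.lin
    (tensorLeftHomEquiv X (ᘁA) A (A' ⊗ X') φ) N (s.1, s.2, p.2) (t.1, t.2, q.2))
      (b, p.1) (c, q.1) = _
  simp only [bend_lin]

lemma tensorLin_act_smul {A A' B B' X X' : CP} (S : (ᘁA : CP) ⊗ A' ⟶ (ᘁB : CP) ⊗ B')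
    {φ ψ : A ⊗ X ⟶ A' ⊗ X'} {r : ℂ} (h : CP.tensorLin φ = r • CP.tensorLin ψ) :
    CP.tensorLin (act S φ) = r • CP.tensorLin (act S ψ) := by
  refine linearMap_ext_single_kronecker fun b c N => ?_
  ext p q
  rw [act_lin, LinearMap.smul_apply, Matrix.smul_apply, act_lin, h, ← Matrix.smul_apply,
    ← map_smul]
  rfl

lemma tensorLin_braiding (A B : CP) (M : Matrix (A.idx × B.idx) (A.idx × B.idx) ℂ)
    (p q : B.idx × A.idx) : CP.tensorLin (β_ A B).hom M p q = M p.swap q.swap := rfl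

lemma act_braiding_lin {A A' B B' : CP} (S : (ᘁA : CP) ⊗ A' ⟶ (ᘁB : CP) ⊗ B') (b c : B.idx)
    (N : Matrix A'.idx A'.idx ℂ) (p q : B'.idx × A.idx) :
    CP.tensorLin (act S (β_ A A').hom) (single b c (1 : ℂ) ⊗ₖ N) p q =
      CP.tensorLin S (single p.2 q.2 (1 : ℂ) ⊗ₖ N) (b, p.1) (c, q.1) := by
  rw [act_lin]
  have h : (of fun s t : A.idx × A'.idx => CP.tensorLin (β_ A A').hom
      (single s.1 t.1 (1 : ℂ) ⊗ₖ N) (s.2, p.2) (t.2, q.2)) = single p.2 q.2 (1 : ℂ) ⊗ₖ N := by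
    ext s t
    simp [tensorLin_braiding, single_apply, eq_comm]
  rw [h]

/-- A supermap is determined by its action on the swap. -/
lemma act_braiding_injective {A A' B B' : CP} {S T : (ᘁA : CP) ⊗ A' ⟶ (ᘁB : CP) ⊗ B'}
    (h : act S (β_ A A').hom = act T (β_ A A').hom) : S = T := by
  refine CP.tensorLin_injective (linearMap_ext_single_kronecker fun x y N => ?_)
  ext p q
  have h1 := act_braiding_lin S p.1 q.1 N (p.2, x) (q.2, y)
  rw [h, act_braiding_lin T] at h1
  exact h1.symm

/-- Conjugation by a matrix that sends each basis vector to a sum of basis vectors. -/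
lemma conj_sum_apply {a b x : Type} [Fintype a] [DecidableEq a] [Fintype x] (h : b → x → a)
    (Q : Matrix a a ℂ) (p q : b) :
    conj (of fun p s => ∑ i, if h p i = s then 1 else 0) Q p q =
      ∑ i, ∑ j, Q (h p i) (h q j) := by
  have h1 (p : b) (f : a → ℂ) : ∑ s, (∑ i, if h p i = s then (1 : ℂ) else 0) * f s =
      ∑ i, f (h p i) := by
    simp_rw [Finset.sum_mul]
    rw [Finset.sum_comm]
    simp
  change ∑ t, (∑ s, (∑ i, if h p i = s then (1 : ℂ) else 0) * Q s t) *
    star (∑ i, if h q i = t then (1 : ℂ) else 0) = _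
  simp only [h1, star_sum, apply_ite star, star_one, star_zero]
  rw [Finset.sum_congr rfl fun t _ => mul_comm _ _, h1, Finset.sum_comm]

/-- Conjugation by a partially defined relabelling. -/
lemma conj_ite_apply {a b : Type} [Fintype a] [DecidableEq a] (h : b → a) (c : b → Prop)
    [DecidablePred c] (Q : Matrix a a ℂ) (p q : b) :
    conj (of fun p s => if h p = s then if c p then 1 else 0 else 0) Q p q =
      if c p ∧ c q then Q (h p) (h q) else 0 := by
  simp only [conj, LinearMap.coe_mk, AddHom.coe_mk, Matrix.mul_apply, of_apply,
    conjTranspose_apply, apply_ite star, star_one, star_zero]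
  by_cases hp : c p <;> by_cases hq : c q <;> simp [hp, hq]

/-- The supermap obtained from a morphism `T : B ⊗ A' ⟶ B' ⊗ A` by bending `B` and `A`: a
conjugation inserts a Bell pair on `B`, and another one projects the two copies of `A` on the Bell
vector. -/
def unbraid {A A' B B' : CP} (T : B ⊗ A' ⟶ B' ⊗ A) : (ᘁA : CP) ⊗ A' ⟶ (ᘁB : CP) ⊗ B' where
  lin := conj (of fun (p : B.idx × B'.idx) (s : (B.idx × A.idx) × (B'.idx × A.idx)) =>
        ∑ x : A.idx, if ((p.1, x), (p.2, x)) = s then 1 else 0) ∘ₗ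
    ampLeft (B.idx × A.idx) (CP.tensorLin T) ∘ₗ
    conj (of fun (s : (B.idx × A.idx) × (B.idx × A'.idx)) (p : A.idx × A'.idx) =>
        if (s.1.2, s.2.2) = p then if s.1.1 = s.2.1 then 1 else 0 else 0)
  isCP := (IsCompletelyPositive.conj _).comp
    ((IsCompletelyPositive.ampLeft T.isCP _).comp (IsCompletelyPositive.conj _))

lemma unbraid_lin {A A' B B' : CP} (T : B ⊗ A' ⟶ B' ⊗ A) (x y : A.idx)
    (N : Matrix A'.idx A'.idx ℂ) (p q : B.idx × B'.idx) :
    CP.tensorLin (unbraid T) (single x y (1 : ℂ) ⊗ₖ N) p q =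
      CP.tensorLin T (single p.1 q.1 (1 : ℂ) ⊗ₖ N) (p.2, x) (q.2, y) := by
  have h (s t : B.idx × A.idx) : (of fun i j : B.idx × A'.idx =>
      conj (of fun (s : (B.idx × A.idx) × (B.idx × A'.idx)) (p : A.idx × A'.idx) =>
        if (s.1.2, s.2.2) = p then if s.1.1 = s.2.1 then 1 else 0 else 0)
        (single x y (1 : ℂ) ⊗ₖ N) (s, i) (t, j)) =
      (if x = s.2 ∧ y = t.2 then (1 : ℂ) else 0) • (single s.1 t.1 (1 : ℂ) ⊗ₖ N) := by
    ext i j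
    rw [of_apply, conj_ite_apply (fun s : (B.idx × A.idx) × (B.idx × A'.idx) => (s.1.2, s.2.2))
      (fun s => s.1.1 = s.2.1)]
    simp only [kroneckerMap_apply, single_apply, Matrix.smul_apply, smul_eq_mul]
    split_ifs <;> simp_all
  change conj _ (of fun s t : (B.idx × A.idx) × (B'.idx × A.idx) => CP.tensorLin T
    (of fun i j : B.idx × A'.idx =>
      conj (of fun (s : (B.idx × A.idx) × (B.idx × A'.idx)) (p : A.idx × A'.idx) =>
        if (s.1.2, s.2.2) = p then if s.1.1 = s.2.1 then 1 else 0 else 0)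
        (single x y (1 : ℂ) ⊗ₖ N) (s.1, i) (t.1, j)) s.2 t.2) p q = _
  simp only [h, map_smul]
  rw [conj_sum_apply fun (p : B.idx × B'.idx) (x : A.idx) => ((p.1, x), (p.2, x))]
  simp [ite_and]

lemma act_unbraid {A A' B B' : CP} (T : B ⊗ A' ⟶ B' ⊗ A) :
    act (unbraid T) (β_ A A').hom = T := by
  refine CP.tensorLin_injective (linearMap_ext_single_kronecker fun b c N => ?_)
  ext p q
  rw [act_braiding_lin, unbraid_lin]

/-! ### Channels as linear maps -/

lemma IsCompletelyPositive.add {a b : Type} {Φ Ψ : Matrix a a ℂ →ₗ[ℂ] Matrix b b ℂ}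
    (hΦ : IsCompletelyPositive Φ) (hΨ : IsCompletelyPositive Ψ) :
    IsCompletelyPositive (Φ + Ψ) := fun c _ X hX => (hΦ c X hX).add (hΨ c X hX)

lemma IsCompletelyPositive.smul {a b : Type} {Φ : Matrix a a ℂ →ₗ[ℂ] Matrix b b ℂ}
    (hΦ : IsCompletelyPositive Φ) {r : ℂ} (hr : 0 ≤ r) : IsCompletelyPositive (r • Φ) :=
  fun c _ X hX => (hΦ c X hX).smul hr

/-- Pullback of matrices along an arbitrary map of index sets. For an injective map it is the
compression to a coordinate subspace. -/
def compress {a b : Type} (h : b → a) : Matrix a a ℂ →ₗ[ℂ] Matrix b b ℂ where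
  toFun X := X.submatrix h h
  map_add' _ _ := rfl
  map_smul' _ _ := rfl

@[simp] lemma compress_apply {a b : Type} (h : b → a) (X : Matrix a a ℂ) (p q : b) :
    compress h X p q = X (h p) (h q) := rfl

lemma IsCompletelyPositive.compress {a b : Type} (h : b → a) :
    IsCompletelyPositive (compress h) :=
  fun c _ _ hX => hX.submatrix (Prod.map h (_root_.id : c → c))

/-- Preparation of the state `R`. -/
def prepare {x : Type} (R : Matrix x x ℂ) : Matrix Unit Unit ℂ →ₗ[ℂ] Matrix x x ℂ where
  toFun N := N () () • R
  map_add' _ _ := add_smul _ _ _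
  map_smul' _ _ := mul_smul _ _ _

@[simp] lemma prepare_apply {x : Type} (R : Matrix x x ℂ) (N : Matrix Unit Unit ℂ) :
    prepare R N = N () () • R := rfl

lemma isCompletelyPositive_prepare {x : Type} [Finite x] {R : Matrix x x ℂ} (hR : R.PosSemidef) :
    IsCompletelyPositive (prepare R) := by
  intro c _ N hN
  have h : ampRight (prepare R) c N = R ⊗ₖ N.submatrix (fun i => ((), i)) (fun i => ((), i)) := by
    ext p q
    simp [mul_comm]
  exact h ▸ hR.kronecker (hN.submatrix fun i : c => ((), i))

namespace QC

/-- The linear map of a channel. -/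
def lin {X Y : QC} (φ : X ⟶ Y) :
    Matrix X.obj.idx X.obj.idx ℂ →ₗ[ℂ] Matrix Y.obj.idx Y.obj.idx ℂ :=
  φ.hom.lin

/-- The linear map of a channel between tensor products, on matrices over the product of the two
index sets. -/
def tensorLin {A A' X X' : QC} (φ : A ⊗ X ⟶ A' ⊗ X') :
    Matrix (A.obj.idx × X.obj.idx) (A.obj.idx × X.obj.idx) ℂ →ₗ[ℂ]
      Matrix (A'.obj.idx × X'.obj.idx) (A'.obj.idx × X'.obj.idx) ℂ :=
  φ.hom.lin

lemma lin_injective {X Y : QC} {φ ψ : X ⟶ Y} (h : lin φ = lin ψ) : φ = ψ :=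
  WideSubcategory.hom_ext _ (CP.Hom.ext h)

lemma tensorLin_injective {A A' X X' : QC} {φ ψ : A ⊗ X ⟶ A' ⊗ X'}
    (h : tensorLin φ = tensorLin ψ) : φ = ψ :=
  WideSubcategory.hom_ext _ (CP.Hom.ext h)

/-- The channel given by a completely positive trace-preserving linear map. -/
def mk {X Y : QC} (Φ : Matrix X.obj.idx X.obj.idx ℂ →ₗ[ℂ] Matrix Y.obj.idx Y.obj.idx ℂ)
    (h : IsCompletelyPositive Φ) (h' : ∀ N, (Φ N).trace = N.trace) : X ⟶ Y :=
  ⟨⟨Φ, h⟩, h'⟩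

/-- The system with a given index set. -/
def sys (x : Type) [Fintype x] [DecidableEq x] : QC := ⟨⟨x⟩⟩

lemma trace_lin {X Y : QC} (φ : X ⟶ Y) (N : Matrix X.obj.idx X.obj.idx ℂ) :
    (lin φ N).trace = N.trace := φ.property N

/-- Only the zero-dimensional system has a channel to a zero-dimensional system. -/
lemma isEmpty_of_hom {X Y : QC} (φ : X ⟶ Y) [IsEmpty Y.obj.idx] : IsEmpty X.obj.idx :=
  ⟨fun i => by
    have h := trace_lin φ (single i i 1)
    rw [Matrix.trace_single_eq_same, Matrix.trace, Finset.univ_eq_empty, Finset.sum_empty] at h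
    exact zero_ne_one h⟩

/-- The state with density matrix `R`. -/
def state {X : QC} (R : Matrix X.obj.idx X.obj.idx ℂ) (hR : R.PosSemidef) (h : R.trace = 1) :
    𝟙_ QC ⟶ X :=
  mk (X := 𝟙_ QC) (prepare R) (isCompletelyPositive_prepare hR) fun N => by
    change _ = ∑ _i : Unit, _
    erw [prepare_apply, trace_smul, h]
    simp

lemma posSemidef_state {X : QC} (ρ : 𝟙_ QC ⟶ X) :
    (ρ.hom.lin (1 : Matrix Unit Unit ℂ)).PosSemidef := by
  have h := ρ.hom.isCP Unit (1 : Matrix (Unit × Unit) (Unit × Unit) ℂ) PosSemidef.one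
  convert h.submatrix (fun x : X.obj.idx => (x, ())) using 1
  ext i j
  change _ = ρ.hom.lin (of fun i j : Unit => (1 : Matrix (Unit × Unit) (Unit × Unit) ℂ)
    (i, ()) (j, ())) i j
  congr 3

lemma trace_state {X : QC} (ρ : 𝟙_ QC ⟶ X) :
    (ρ.hom.lin (1 : Matrix Unit Unit ℂ)).trace = 1 := by
  refine (ρ.property (1 : Matrix Unit Unit ℂ)).trans ?_
  change ∑ _i : Unit, _ = _
  simp

/-- Insertion of the matrix `R` into the auxiliary input of `Φ`, and discarding of the auxiliary
output. -/
def plugLin {a x a' x' : Type} [Fintype x'] (Φ : Matrix (a × x) (a × x) ℂ →ₗ[ℂ]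
    Matrix (a' × x') (a' × x') ℂ) (R : Matrix x x ℂ) : Matrix a a ℂ →ₗ[ℂ] Matrix a' a' ℂ where
  toFun M := of fun k l => ∑ i, Φ (M ⊗ₖ R) (k, i) (l, i)
  map_add' M N := by
    ext
    simp [add_kronecker, Finset.sum_add_distrib]
  map_smul' r M := by
    ext
    simp [smul_kronecker, Finset.mul_sum]

lemma lin_plug {A A' X X' : QC} (φ : A ⊗ X ⟶ A' ⊗ X') (ρ : 𝟙_ QC ⟶ X) (σ : X' ⟶ 𝟙_ QC) :
    lin (plug ρ φ σ) = plugLin (tensorLin φ) (ρ.hom.lin (1 : Matrix Unit Unit ℂ)) := by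
  obtain rfl : σ = discard X' := isTerminalUnit.hom_ext _ _
  refine LinearMap.ext fun M => Matrix.ext fun k l => ?_
  change ∑ x : X'.obj.idx, tensorLin φ (of fun s t : A.obj.idx × X.obj.idx =>
    lin ρ (of fun _ _ : Unit => M s.1 t.1) s.2 t.2) (k, x) (l, x) = _
  have h : (of fun s t : A.obj.idx × X.obj.idx => lin ρ (of fun _ _ : Unit => M s.1 t.1) s.2 t.2) =
      M ⊗ₖ lin ρ (1 : Matrix Unit Unit ℂ) := by
    ext s t
    have h' : (of fun _ _ : Unit => M s.1 t.1) = M s.1 t.1 • (1 : Matrix Unit Unit ℂ) := by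
      ext; simp
    rw [of_apply, h']
    erw [map_smul]
    rfl
  rw [h]
  rfl

/-- The swap reduces to discard-and-prepare channels, so it is in the dilation extension of every
normal set. -/
lemma braiding_mem_dExt {A A' : QC} {K : Set (A ⟶ A')} (hK : IsNormal K) :
    (β_ A A').hom ∈ dExt K A' A := by
  intro ρ σ
  have h : plug ρ (β_ A A').hom σ = σ ≫ ρ := by
    rw [plug, BraidedCategory.braiding_naturality_right_assoc, ← whisker_exchange_assoc]
    simp
    rfl
  rw [h]
  exact hK σ ρ

/-- Action of a channel on the auxiliary input. -/
def pre {A A' X X' Y : QC} (f : Y ⟶ X) (φ : A ⊗ X ⟶ A' ⊗ X') : A ⊗ Y ⟶ A' ⊗ X' :=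
  insertAux (f ≫ (ρ_ X).inv) φ (ρ_ X').hom

/-- Action of a channel on the auxiliary output. -/
def post {A A' X X' Y : QC} (φ : A ⊗ X ⟶ A' ⊗ X') (g : X' ⟶ Y) : A ⊗ X ⟶ A' ⊗ Y :=
  insertAux (ρ_ X).inv φ ((ρ_ X').hom ≫ g)

lemma tensorLin_pre {A A' X X' Y : QC} (f : Y ⟶ X) (φ : A ⊗ X ⟶ A' ⊗ X') :
    tensorLin (pre f φ) = tensorLin φ ∘ₗ ampLeft A.obj.idx (lin f) := rfl

lemma tensorLin_post {A A' X X' Y : QC} (φ : A ⊗ X ⟶ A' ⊗ X') (g : X' ⟶ Y) :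
    tensorLin (post φ g) = ampLeft A'.obj.idx (lin g) ∘ₗ tensorLin φ := rfl

/-- The channel that adjoins to `X` a system in the state with density matrix `R`. -/
def adjoin (X : QC) {F : QC} (R : Matrix F.obj.idx F.obj.idx ℂ) (hR : R.PosSemidef)
    (h : R.trace = 1) : X ⟶ F ⊗ X :=
  (λ_ X).inv ≫ state R hR h ▷ X

lemma lin_adjoin (X : QC) {F : QC} (R : Matrix F.obj.idx F.obj.idx ℂ) (hR : R.PosSemidef)
    (h : R.trace = 1) (N : Matrix X.obj.idx X.obj.idx ℂ) : lin (adjoin X R hR h) N = R ⊗ₖ N := by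
  ext p q
  exact mul_comm _ _

end QC

namespace QC

/-! ### Locally-applicable transformations are affine -/

/-- Apply `φ` or `ψ`, controlled by a bit that is then discarded. -/
def control {A A' X X' : QC} (φ ψ : A ⊗ X ⟶ A' ⊗ X') : A ⊗ (sys Bool ⊗ X) ⟶ A' ⊗ X' :=
  mk (X := A ⊗ (sys Bool ⊗ X)) (Y := A' ⊗ X')
    (tensorLin φ ∘ₗ compress (fun p : A.obj.idx × X.obj.idx => (p.1, true, p.2)) +
      tensorLin ψ ∘ₗ compress (fun p : A.obj.idx × X.obj.idx => (p.1, false, p.2)))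
    ((φ.hom.isCP.comp (.compress _)).add (ψ.hom.isCP.comp (.compress _))) fun N => by
      refine (trace_add _ _).trans ?_
      refine (congrArg₂ (· + ·) (φ.property _) (ψ.property _)).trans ?_
      change ∑ p : A.obj.idx × X.obj.idx, N (p.1, true, p.2) (p.1, true, p.2) +
        ∑ p : A.obj.idx × X.obj.idx, N (p.1, false, p.2) (p.1, false, p.2) =
          ∑ p : A.obj.idx × Bool × X.obj.idx, N p p
      simp only [Fintype.sum_prod_type, Fintype.sum_bool, Finset.sum_add_distrib]
      rfl

lemma tensorLin_control {A A' X X' : QC} (φ ψ : A ⊗ X ⟶ A' ⊗ X')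
    (N : Matrix (A.obj.idx × Bool × X.obj.idx) (A.obj.idx × Bool × X.obj.idx) ℂ) :
    tensorLin (control φ ψ) N =
      tensorLin φ (N.submatrix (fun p => (p.1, true, p.2)) (fun p => (p.1, true, p.2))) +
      tensorLin ψ (N.submatrix (fun p => (p.1, false, p.2)) (fun p => (p.1, false, p.2))) := rfl

/-- The reduction of an element of the dilation extension by an unnormalised state is a multiple of
an element of `K`. -/
lemma exists_plugLin_eq_smul {A A' X X' : QC} {K : Set (A ⟶ A')} {φ : A ⊗ X ⟶ A' ⊗ X'}
    (hφ : φ ∈ dExt K X X') {R : Matrix X.obj.idx X.obj.idx ℂ} (hR : R.PosSemidef) {t : ℝ}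
    (ht : R.trace = t) (h0 : 0 < t) : ∃ κ ∈ K, plugLin (tensorLin φ) R = t • lin κ := by
  have hR' : ((t⁻¹ : ℝ) • R).PosSemidef := hR.smul (by positivity)
  have htr : ((t⁻¹ : ℝ) • R).trace = 1 := by
    rw [trace_smul, ht, Complex.real_smul, ← Complex.ofReal_mul, inv_mul_cancel₀ h0.ne',
      Complex.ofReal_one]
  refine ⟨_, hφ (state _ hR' htr) (discard X'), ?_⟩
  rw [lin_plug]
  refine LinearMap.ext fun M => Matrix.ext fun k l => ?_
  have h : (state _ hR' htr).hom.lin (1 : Matrix Unit Unit ℂ) = (t⁻¹ : ℝ) • R :=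
    one_smul ℂ _
  rw [h]
  simp only [plugLin, LinearMap.coe_mk, AddHom.coe_mk, LinearMap.smul_apply, of_apply,
    Matrix.smul_apply, kronecker_smul, LinearMap.map_smul_of_tower, ← Finset.smul_sum]
  rw [smul_smul, mul_inv_cancel₀ h0.ne', one_smul]

lemma plugLin_zero {a x a' x' : Type} [Fintype x'] (Φ : Matrix (a × x) (a × x) ℂ →ₗ[ℂ]
    Matrix (a' × x') (a' × x') ℂ) : plugLin Φ 0 = 0 := by
  refine LinearMap.ext fun M => Matrix.ext fun k l => ?_
  simp [plugLin]

lemma control_mem_dExt {A A' X X' : QC} {K : Set (A ⟶ A')} (hK : IsConvex K)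
    {φ ψ : A ⊗ X ⟶ A' ⊗ X'} (hφ : φ ∈ dExt K X X') (hψ : ψ ∈ dExt K X X') :
    control φ ψ ∈ dExt K (sys Bool ⊗ X) X' := by
  intro ρ σ
  set R : Matrix (Bool × X.obj.idx) (Bool × X.obj.idx) ℂ :=
    ρ.hom.lin (1 : Matrix Unit Unit ℂ) with hR
  have hpos : R.PosSemidef := posSemidef_state ρ
  have htr : R.trace = 1 := trace_state ρ
  let R' (b : Bool) : Matrix X.obj.idx X.obj.idx ℂ :=
    R.submatrix (fun x => (b, x)) (fun x => (b, x))
  have hpos' (b : Bool) : (R' b).PosSemidef := hpos.submatrix _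
  have hsum : (R' true).trace + (R' false).trace = 1 := by
    rw [← htr]
    simp [Matrix.trace, R', Fintype.sum_prod_type]
  have hlin : lin (plug ρ (control φ ψ) σ) =
      plugLin (tensorLin φ) (R' true) + plugLin (tensorLin ψ) (R' false) := by
    rw [lin_plug]
    refine LinearMap.ext fun M => Matrix.ext fun k l => ?_
    simp only [plugLin, LinearMap.coe_mk, AddHom.coe_mk, LinearMap.add_apply, of_apply,
      Matrix.add_apply, ← Finset.sum_add_distrib]
    rfl
  have hre (b : Bool) : ∃ t : ℝ, 0 ≤ t ∧ (R' b).trace = t := by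
    have h := Complex.nonneg_iff.1 (hpos' b).trace_nonneg
    exact ⟨_, h.1, Complex.ext rfl h.2.symm⟩
  suffices h : lin (plug ρ (control φ ψ) σ) ∈ (fun φ : A ⟶ A' => φ.hom.lin) '' K by
    obtain ⟨κ, hκ, h⟩ := h
    rwa [← lin_injective h]
  obtain ⟨s, hs0, hs⟩ := hre true
  obtain ⟨t, ht0, ht⟩ := hre false
  have hst : s + t = 1 := by
    rw [hs, ht] at hsum
    exact_mod_cast hsum
  rw [hlin]
  -- The reduction is a convex combination of elements of `K`, weighted by the distribution of the
  -- control bit. A branch of probability zero has no normalised state, but also no contribution.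
  rcases hs0.eq_or_lt with rfl | hs0
  · obtain rfl : t = 1 := by simpa using hst
    obtain ⟨κ, hκ, h⟩ := exists_plugLin_eq_smul hψ (hpos' false) ht one_pos
    rw [(hpos' true).trace_eq_zero_iff.1 (by simpa using hs), plugLin_zero, zero_add, h, one_smul]
    exact ⟨κ, hκ, rfl⟩
  rcases ht0.eq_or_lt with rfl | ht0
  · obtain rfl : s = 1 := by simpa using hst
    obtain ⟨κ, hκ, h⟩ := exists_plugLin_eq_smul hφ (hpos' true) hs one_pos
    rw [(hpos' false).trace_eq_zero_iff.1 (by simpa using ht), plugLin_zero, add_zero, h, one_smul]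
    exact ⟨κ, hκ, rfl⟩
  obtain ⟨κ, hκ, h⟩ := exists_plugLin_eq_smul hφ (hpos' true) hs hs0
  obtain ⟨μ, hμ, h'⟩ := exists_plugLin_eq_smul hψ (hpos' false) ht ht0
  rw [h, h']
  exact hK ⟨κ, hκ, rfl⟩ ⟨μ, hμ, rfl⟩ hs0.le ht0.le hst

lemma posSemidef_single {x : Type} [Fintype x] [DecidableEq x] (i : x) :
    (single i i (1 : ℂ)).PosSemidef := by
  rw [← diagonal_single]
  exact PosSemidef.diagonal fun j => by
    by_cases h : j = i <;> simp [h]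

/-- Adjoin a bit in the basis state `b`. -/
def adjoinBit (X : QC) (b : Bool) : X ⟶ sys Bool ⊗ X :=
  adjoin X (F := sys Bool) (single b b 1) (posSemidef_single b) (Matrix.trace_single_eq_same _ _)

lemma lin_adjoinBit (X : QC) (b : Bool) (N : Matrix X.obj.idx X.obj.idx ℂ) :
    lin (adjoinBit X b) N = single b b 1 ⊗ₖ N := lin_adjoin _ _ _ _ _

/-- Adjoin a bit that is true with probability `t`. -/
noncomputable def adjoinCoin (X : QC) (t : ℝ) (h0 : 0 ≤ t) (h1 : t ≤ 1) : X ⟶ sys Bool ⊗ X :=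
  adjoin X (F := sys Bool) (t • single true true 1 + (1 - t) • single false false 1)
    (((posSemidef_single true).smul h0).add ((posSemidef_single false).smul (sub_nonneg.2 h1)))
    (by
      refine (trace_add _ _).trans ?_
      erw [trace_smul, trace_smul, Matrix.trace_single_eq_same, Matrix.trace_single_eq_same,
        ← add_smul]
      simp)

lemma lin_adjoinCoin (X : QC) (t : ℝ) (h0 : 0 ≤ t) (h1 : t ≤ 1) :
    lin (adjoinCoin X t h0 h1) =
      (t : ℂ) • lin (adjoinBit X true) + ((1 - t : ℝ) : ℂ) • lin (adjoinBit X false) := by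
  refine LinearMap.ext fun N => ?_
  refine (lin_adjoin _ _ _ _ _).trans ?_
  refine (add_kronecker _ _ _).trans ?_
  refine (congrArg₂ (· + ·) (smul_kronecker _ _ _) (smul_kronecker _ _ _)).trans ?_
  rw [LinearMap.add_apply, LinearMap.smul_apply, LinearMap.smul_apply, lin_adjoinBit,
    lin_adjoinBit]
  rfl

lemma ampLeft_add {a b c : Type} (Φ Ψ : Matrix a a ℂ →ₗ[ℂ] Matrix b b ℂ) :
    ampLeft c (Φ + Ψ) = ampLeft c Φ + ampLeft c Ψ := rfl

lemma ampLeft_smul {a b c : Type} (r : ℂ) (Φ : Matrix a a ℂ →ₗ[ℂ] Matrix b b ℂ) :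
    ampLeft c (r • Φ) = r • ampLeft c Φ := rfl

lemma submatrix_pair_single_kronecker {a x : Type} (b c : Bool)
    (N : Matrix (a × x) (a × x) ℂ) :
    (of fun p q : a × Bool × x => (single b b (1 : ℂ) ⊗ₖ of fun i j => N (p.1, i) (q.1, j))
      p.2 q.2).submatrix (fun p : a × x => (p.1, c, p.2)) (fun p : a × x => (p.1, c, p.2)) =
      if b = c then N else 0 := by
  ext p q
  by_cases h : b = c <;> simp [h, single_apply]

lemma pre_adjoinBit_control {A A' X X' : QC} (φ ψ : A ⊗ X ⟶ A' ⊗ X') (b : Bool) :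
    pre (adjoinBit X b) (control φ ψ) = bif b then φ else ψ := by
  refine tensorLin_injective (LinearMap.ext fun N => ?_)
  rw [tensorLin_pre, LinearMap.comp_apply]
  refine (tensorLin_control _ _ _).trans ?_
  have h : ampLeft A.obj.idx (lin (adjoinBit X b)) N =
      of fun p q : A.obj.idx × Bool × X.obj.idx =>
        (single b b (1 : ℂ) ⊗ₖ of fun i j => N (p.1, i) (q.1, j)) p.2 q.2 := by
    ext p q
    rw [ampLeft_apply, lin_adjoinBit]
    rfl
  rw [h, submatrix_pair_single_kronecker, submatrix_pair_single_kronecker]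
  cases b <;> simp

lemma tensorLin_pre_adjoinCoin {A A' X X' : QC} (t : ℝ) (h0 : 0 ≤ t) (h1 : t ≤ 1)
    (φ : A ⊗ (sys Bool ⊗ X) ⟶ A' ⊗ X') :
    tensorLin (pre (adjoinCoin X t h0 h1) φ) = (t : ℂ) • tensorLin (pre (adjoinBit X true) φ) +
      ((1 - t : ℝ) : ℂ) • tensorLin (pre (adjoinBit X false) φ) := by
  simp only [tensorLin_pre, lin_adjoinCoin, ampLeft_add, ampLeft_smul, LinearMap.comp_add,
    LinearMap.comp_smul]

lemma tensorLin_post_adjoinCoin {A A' X X' : QC} (t : ℝ) (h0 : 0 ≤ t) (h1 : t ≤ 1)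
    (φ : A ⊗ X ⟶ A' ⊗ X') :
    tensorLin (post φ (adjoinCoin X' t h0 h1)) = (t : ℂ) • tensorLin (post φ (adjoinBit X' true)) +
      ((1 - t : ℝ) : ℂ) • tensorLin (post φ (adjoinBit X' false)) := by
  simp only [tensorLin_post, lin_adjoinCoin, ampLeft_add, ampLeft_smul, LinearMap.add_comp,
    LinearMap.smul_comp]

end QC

variable {K M : ExtObj QC}

lemma LocallyApplicable.app_pre (S : LocallyApplicable K M) {X X' Y : QC} (f : Y ⟶ X)
    {φ : K.A ⊗ X ⟶ K.A' ⊗ X'} (hφ : φ ∈ K.ext.carrier X X')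
    (hφ' : QC.pre f φ ∈ K.ext.carrier Y X') :
    (S.app Y X' ⟨QC.pre f φ, hφ'⟩).1 = QC.pre f (S.app X X' ⟨φ, hφ⟩).1 :=
  S.app_insertAux _ _ ⟨φ, hφ⟩

lemma LocallyApplicable.app_post (S : LocallyApplicable K M) {X X' Y : QC} (g : X' ⟶ Y)
    {φ : K.A ⊗ X ⟶ K.A' ⊗ X'} (hφ : φ ∈ K.ext.carrier X X')
    (hφ' : QC.post φ g ∈ K.ext.carrier X Y) :
    (S.app X Y ⟨QC.post φ g, hφ'⟩).1 = QC.post (S.app X X' ⟨φ, hφ⟩).1 g :=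
  S.app_insertAux _ _ ⟨φ, hφ⟩

lemma IsNormalConvex.carrier_eq (hK : IsNormalConvex K) (X X' : QC) :
    K.ext.carrier X X' = dExt K.K X X' := by
  rw [hK.2.2]
  rfl

/-- A locally-applicable transformation `S` respects equal mixtures. The channel `control φ ψ` becomes
`φ`, `ψ` and their mixture under three actions on its control bit, and `S` commutes with these
actions. -/
lemma LocallyApplicable.exists_tensorLin_add (S : LocallyApplicable K M) (hK : IsNormalConvex K)
    {X X' : QC} (φ ψ : K.ext.carrier X X') : ∃ θ : K.ext.carrier X X',
      QC.tensorLin θ.1 = (1 / 2 : ℂ) • (QC.tensorLin φ.1 + QC.tensorLin ψ.1) ∧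
      QC.tensorLin (S.app X X' θ).1 =
        (1 / 2 : ℂ) • (QC.tensorLin (S.app X X' φ).1 + QC.tensorLin (S.app X X' ψ).1) := by
  have hc : QC.control φ.1 ψ.1 ∈ K.ext.carrier (QC.sys Bool ⊗ X) X' := by
    rw [hK.carrier_eq]
    exact QC.control_mem_dExt hK.1 (hK.carrier_eq _ _ ▸ φ.2) (hK.carrier_eq _ _ ▸ ψ.2)
  have hmem {Y : QC} (f : Y ⟶ QC.sys Bool ⊗ X) :
      QC.pre f (QC.control φ.1 ψ.1) ∈ K.ext.carrier Y X' := K.ext.insertAux_mem _ _ hc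
  have hbit (b : Bool) : (S.app X X' (bif b then φ else ψ)).1 =
      QC.pre (QC.adjoinBit X b) (S.app _ X' ⟨_, hc⟩).1 := by
    rw [← S.app_pre _ hc (hmem _)]
    congr 2
    refine Subtype.ext (Eq.trans ?_ (QC.pre_adjoinBit_control _ _ _).symm)
    cases b <;> rfl
  refine ⟨⟨_, hmem (QC.adjoinCoin X (1 / 2) (by norm_num) (by norm_num))⟩, ?_, ?_⟩
  · rw [QC.tensorLin_pre_adjoinCoin, QC.pre_adjoinBit_control, QC.pre_adjoinBit_control, smul_add]
    norm_num
  · rw [S.app_pre _ hc, QC.tensorLin_pre_adjoinCoin, ← hbit true, ← hbit false, smul_add]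
    norm_num

/-- An equation between sums of two channels is preserved, since both sides define the same equal
mixture. -/
lemma LocallyApplicable.tensorLin_add_eq (S : LocallyApplicable K M) (hK : IsNormalConvex K)
    {X X' : QC} {φ₁ φ₂ ψ₁ ψ₂ : K.ext.carrier X X'}
    (h : QC.tensorLin φ₁.1 + QC.tensorLin φ₂.1 = QC.tensorLin ψ₁.1 + QC.tensorLin ψ₂.1) :
    QC.tensorLin (S.app X X' φ₁).1 + QC.tensorLin (S.app X X' φ₂).1 =
      QC.tensorLin (S.app X X' ψ₁).1 + QC.tensorLin (S.app X X' ψ₂).1 := by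
  obtain ⟨θ, h1, h2⟩ := S.exists_tensorLin_add hK φ₁ φ₂
  obtain ⟨θ', h3, h4⟩ := S.exists_tensorLin_add hK ψ₁ ψ₂
  obtain rfl : θ = θ' := Subtype.ext (QC.tensorLin_injective (by rw [h1, h3, h]))
  exact smul_right_injective _ (by norm_num : (1 / 2 : ℂ) ≠ 0) (h2.symm.trans h4)

/-! ### The Bell measurement -/

section Bell

variable (n : Type) [Fintype n] [DecidableEq n]

lemma bell_conjTranspose_mul_bell :
    (CP.bell n)ᴴ * CP.bell n = (Fintype.card n : ℂ) • (1 : Matrix Unit Unit ℂ) := by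
  ext i j
  simp [CP.bell, Matrix.mul_apply, Fintype.sum_prod_type]

lemma conj_bell_conjTranspose_apply (Q : Matrix (n × n) (n × n) ℂ) :
    conj (CP.bell n)ᴴ Q () () = ∑ k, ∑ l, Q (k, k) (l, l) := by
  simp only [conj, CP.bell, LinearMap.coe_mk, AddHom.coe_mk, Matrix.mul_apply, of_apply,
    conjTranspose_apply, conjTranspose_conjTranspose, Fintype.sum_prod_type]
  simp
  exact Finset.sum_comm

/-- The projection on the Bell vector. -/
noncomputable def bellProj : Matrix (n × n) (n × n) ℂ :=
  (Fintype.card n : ℂ)⁻¹ • (CP.bell n * (CP.bell n)ᴴ)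

lemma bellProj_apply (p q : n × n) :
    bellProj n p q = if p.1 = p.2 ∧ q.1 = q.2 then (Fintype.card n : ℂ)⁻¹ else 0 := by
  simp only [bellProj, CP.bell, Matrix.smul_apply, Matrix.mul_apply, of_apply,
    conjTranspose_apply, Finset.univ_unique, Finset.sum_singleton]
  split_ifs <;> simp_all

lemma posSemidef_bellProj : (bellProj n).PosSemidef :=
  (posSemidef_self_mul_conjTranspose _).smul (by positivity)

lemma isHermitian_bellProj : (bellProj n)ᴴ = bellProj n := (posSemidef_bellProj n).1

lemma trace_bellProj_mul (Q : Matrix (n × n) (n × n) ℂ) :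
    (bellProj n * Q).trace = (Fintype.card n : ℂ)⁻¹ * conj (CP.bell n)ᴴ Q () () := by
  rw [bellProj, smul_mul, trace_smul, Matrix.mul_assoc, trace_mul_comm, smul_eq_mul]
  congr 1
  simp [conj, Matrix.trace]

variable [Nonempty n]

lemma trace_bellProj : (bellProj n).trace = 1 := by
  rw [bellProj, trace_smul, trace_mul_comm, bell_conjTranspose_mul_bell]
  simp

lemma bellProj_mul_self : bellProj n * bellProj n = bellProj n := by
  have h : (Fintype.card n : ℂ) ≠ 0 := by simp
  rw [bellProj, smul_mul, Matrix.mul_smul, Matrix.mul_assoc, ← Matrix.mul_assoc _ (CP.bell n),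
    bell_conjTranspose_mul_bell, smul_mul, Matrix.one_mul, Matrix.mul_smul, smul_smul, smul_smul,
    mul_assoc, inv_mul_cancel₀ h, mul_one]

/-- The measurement of whether a pair of systems is in the Bell state. The outcome is a bit. -/
noncomputable def bellMeasure : Matrix (n × n) (n × n) ℂ →ₗ[ℂ] Matrix Bool Bool ℂ :=
  prepare (single true true 1) ∘ₗ ((Fintype.card n : ℂ)⁻¹ • conj (CP.bell n)ᴴ) +
    prepare (single false false 1) ∘ₗ traceMap (n × n) ∘ₗ conj (1 - bellProj n)

lemma isCompletelyPositive_bellMeasure : IsCompletelyPositive (bellMeasure n) :=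
  ((isCompletelyPositive_prepare (QC.posSemidef_single _)).comp
    ((IsCompletelyPositive.conj _).smul (by positivity))).add
  ((isCompletelyPositive_prepare (QC.posSemidef_single _)).comp
    (isCompletelyPositive_traceMap.comp (.conj _)))

lemma trace_bellMeasure (Q : Matrix (n × n) (n × n) ℂ) : (bellMeasure n Q).trace = Q.trace := by
  have h : (conj (1 - bellProj n) Q).trace =
      Q.trace - (Fintype.card n : ℂ)⁻¹ * conj (CP.bell n)ᴴ Q () () := by
    rw [← trace_bellProj_mul, ← trace_sub]
    change ((1 - bellProj n) * Q * (1 - bellProj n)ᴴ).trace = _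
    rw [trace_mul_comm, ← Matrix.mul_assoc, conjTranspose_sub, conjTranspose_one,
      isHermitian_bellProj]
    congr 1
    simp only [Matrix.mul_sub, Matrix.sub_mul, bellProj_mul_self, Matrix.one_mul, Matrix.mul_one]
    abel
  have h' : traceMap (n × n) (conj (1 - bellProj n) Q) () () =
    (conj (1 - bellProj n) Q).trace := rfl
  simp only [bellMeasure, LinearMap.add_apply, LinearMap.comp_apply, prepare_apply, trace_add,
    trace_smul, Matrix.trace_single_eq_same, LinearMap.smul_apply, h', h, Matrix.smul_apply,
    smul_eq_mul, mul_one]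
  ring

omit [Nonempty n] in
lemma bellMeasure_true (Q : Matrix (n × n) (n × n) ℂ) :
    bellMeasure n Q true true = (Fintype.card n : ℂ)⁻¹ * ∑ k, ∑ l, Q (k, k) (l, l) := by
  simp [bellMeasure, conj_bell_conjTranspose_apply]

omit [Nonempty n] in
lemma bellMeasure_of_ne (Q : Matrix (n × n) (n × n) ℂ) {i j : Bool} (h : i ≠ j) :
    bellMeasure n Q i j = 0 := by
  cases i <;> cases j <;> simp_all [bellMeasure]

end Bell

/-! ### Simulation of a channel by the swap -/

namespace QC

variable {A A' X X' : QC}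

/-- The block `⟨i|χ|j⟩` of a channel one of whose outputs is a bit. -/
def block (χ : A ⊗ X ⟶ A' ⊗ (sys Bool ⊗ X')) (i j : Bool) :
    Matrix (A.obj.idx × X.obj.idx) (A.obj.idx × X.obj.idx) ℂ →ₗ[ℂ]
      Matrix (A'.obj.idx × X'.obj.idx) (A'.obj.idx × X'.obj.idx) ℂ where
  toFun M := (tensorLin χ M).submatrix (fun p => (p.1, i, p.2)) (fun p => (p.1, j, p.2))
  map_add' M N := by rw [map_add]; rfl
  map_smul' r M := by rw [map_smul]; rfl

lemma tensorLin_add_eq_iff {χ₁ χ₂ χ₃ χ₄ : A ⊗ X ⟶ A' ⊗ (sys Bool ⊗ X')} :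
    tensorLin χ₁ + tensorLin χ₂ = tensorLin χ₃ + tensorLin χ₄ ↔
      ∀ i j, block χ₁ i j + block χ₂ i j = block χ₃ i j + block χ₄ i j := by
  constructor
  · intro h i j
    refine LinearMap.ext fun M => Matrix.ext fun p q => ?_
    exact congrFun (congrFun (LinearMap.congr_fun h M) (p.1, i, p.2)) (q.1, j, q.2)
  · intro h
    refine LinearMap.ext fun M => Matrix.ext fun p q => ?_
    exact congrFun (congrFun (LinearMap.congr_fun (h p.2.1 q.2.1) M) (p.1, p.2.2)) (q.1, q.2.2)

lemma block_post_adjoinBit (χ : A ⊗ X ⟶ A' ⊗ X') (b i j : Bool) :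
    block (post χ (adjoinBit X' b)) i j = single b b (1 : ℂ) i j • tensorLin χ := by
  refine LinearMap.ext fun M => Matrix.ext fun p q => ?_
  change lin (adjoinBit X' b) (of fun x y => tensorLin χ M (p.1, x) (q.1, y)) (i, p.2) (j, q.2) = _
  rw [lin_adjoinBit]
  rfl

lemma block_post_adjoinCoin (χ : A ⊗ X ⟶ A' ⊗ X') (t : ℝ) (h0 : 0 ≤ t) (h1 : t ≤ 1) (i j : Bool) :
    block (post χ (adjoinCoin X' t h0 h1)) i j =
      (t : ℂ) • block (post χ (adjoinBit X' true)) i j +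
        ((1 - t : ℝ) : ℂ) • block (post χ (adjoinBit X' false)) i j := by
  refine LinearMap.ext fun M => Matrix.ext fun p q => ?_
  exact congrFun (congrFun (LinearMap.congr_fun (tensorLin_post_adjoinCoin t h0 h1 χ) M)
    (p.1, i, p.2)) (q.1, j, q.2)

/-- Discard the bit. -/
def eraseBit (X : QC) : sys Bool ⊗ X ⟶ X := discard (sys Bool) ▷ X ≫ (λ_ X).hom

lemma tensorLin_post_eraseBit (χ : A ⊗ X ⟶ A' ⊗ (sys Bool ⊗ X')) :
    tensorLin (post χ (eraseBit X')) = block χ true true + block χ false false := by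
  refine LinearMap.ext fun M => Matrix.ext fun p q => ?_
  exact Fintype.sum_bool fun b =>
    (tensorLin χ M : Matrix (A'.obj.idx × Bool × X'.obj.idx) (A'.obj.idx × Bool × X'.obj.idx) ℂ)
      (p.1, b, p.2) (q.1, b, q.2)

/-- If `ψ` has a classical bit as an output, and equals `t φ` when that bit is true, then a coin
flip between `ψ` and `φ` with the bit set to false does not change when one resets the bit in `ψ`,
and instead sets the bit in `φ` to true with probability `t`. -/
lemma tensorLin_add_eq_of_block {φ : A ⊗ X ⟶ A' ⊗ X'} {ψ : A ⊗ X ⟶ A' ⊗ (sys Bool ⊗ X')}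
    {t : ℝ} (h0 : 0 ≤ t) (h1 : t ≤ 1) (hne : ∀ i j, i ≠ j → block ψ i j = 0)
    (htrue : block ψ true true = (t : ℂ) • tensorLin φ) :
    tensorLin ψ + tensorLin (post φ (adjoinBit X' false)) =
      tensorLin (post (post ψ (eraseBit X')) (adjoinBit X' false)) +
        tensorLin (post φ (adjoinCoin X' t h0 h1)) := by
  rw [tensorLin_add_eq_iff]
  intro i j
  rw [block_post_adjoinCoin, block_post_adjoinBit, block_post_adjoinBit, block_post_adjoinBit,
    tensorLin_post_eraseBit, htrue]
  cases i <;> cases j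
  · simp only [single_apply]
    simp
    module
  · simp [hne]
  · simp [hne]
  · simp [htrue]

section Simulation

variable [Nonempty A'.obj.idx]

/-- Preparation of a Bell pair next to `X`. -/
noncomputable def bellPair (A' X : QC) [Nonempty A'.obj.idx] : X ⟶ A' ⊗ (A' ⊗ X) :=
  adjoin X (F := A' ⊗ A') (bellProj A'.obj.idx) (posSemidef_bellProj _) (trace_bellProj _) ≫
    (α_ _ _ _).hom

/-- Application of `φ`, followed by the Bell measurement of `A'` and another copy of it. -/
noncomputable def measureAfter (φ : A ⊗ X ⟶ A' ⊗ X') : A ⊗ (A' ⊗ X) ⟶ sys Bool ⊗ X' :=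
  (α_ _ _ _).inv ≫ (β_ A A').hom ▷ X ≫ (α_ _ _ _).hom ≫ A' ◁ φ ≫ (α_ _ _ _).inv ≫
    (mk (X := A' ⊗ A') (Y := sys Bool) (bellMeasure A'.obj.idx)
      (isCompletelyPositive_bellMeasure _) (trace_bellMeasure _)) ▷ X'

/-- Simulation of `φ` by the swap: the input `A` is sent through the swap, `φ` is applied on the
auxiliary side, and the result is teleported to the output of the swap. The Bell measurement
says whether this has worked. -/
noncomputable def simulate (φ : A ⊗ X ⟶ A' ⊗ X') : A ⊗ X ⟶ A' ⊗ (sys Bool ⊗ X') :=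
  insertAux (bellPair A' X) (β_ A A').hom (measureAfter φ)

lemma block_simulate (φ : A ⊗ X ⟶ A' ⊗ X') (i j : Bool)
    (M : Matrix (A.obj.idx × X.obj.idx) (A.obj.idx × X.obj.idx) ℂ)
    (p q : A'.obj.idx × X'.obj.idx) :
    block (simulate φ) i j M p q = bellMeasure A'.obj.idx
      (of fun s t => bellProj A'.obj.idx (p.1, s.1) (q.1, t.1) *
        tensorLin φ M (s.2, p.2) (t.2, q.2)) i j := by
  change bellMeasure A'.obj.idx
      (of fun s t => tensorLin φ (of fun u v : A.obj.idx × X.obj.idx =>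
        M u v * bellProj A'.obj.idx (p.1, s.1) (q.1, t.1)) (s.2, p.2) (t.2, q.2)) i j = _
  have h (s t : A'.obj.idx × A'.obj.idx) : (of fun u v : A.obj.idx × X.obj.idx =>
        M u v * bellProj A'.obj.idx (p.1, s.1) (q.1, t.1)) =
      bellProj A'.obj.idx (p.1, s.1) (q.1, t.1) • M := by
    ext u v
    exact mul_comm _ _
  simp only [h, map_smul]
  rfl

lemma block_simulate_of_ne (φ : A ⊗ X ⟶ A' ⊗ X') (i j : Bool) (h : i ≠ j) :
    block (simulate φ) i j = 0 := by
  refine LinearMap.ext fun M => Matrix.ext fun p q => ?_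
  rw [block_simulate, bellMeasure_of_ne _ _ h]
  rfl

lemma block_simulate_true (φ : A ⊗ X ⟶ A' ⊗ X') :
    block (simulate φ) true true =
      (((Fintype.card A'.obj.idx : ℝ)⁻¹ ^ 2 : ℝ) : ℂ) • tensorLin φ := by
  refine LinearMap.ext fun M => Matrix.ext fun p q => ?_
  rw [block_simulate, bellMeasure_true]
  simp [bellProj_apply, ite_and]
  ring

end Simulation

end QC

/-- The supermap that reproduces a locally-applicable transformation: its action on the swap is
prescribed. -/
def LocallyApplicable.toSupermap (S : LocallyApplicable K M)
    (h : (β_ K.A K.A').hom ∈ K.ext.carrier K.A' K.A) :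
    (ᘁK.A.obj : CP) ⊗ K.A'.obj ⟶ (ᘁM.A.obj : CP) ⊗ M.A'.obj :=
  unbraid (S.app K.A' K.A ⟨_, h⟩).1.hom

/-- The part of `QC.measureAfter φ` in which the measurement succeeds. -/
noncomputable def QC.successAfter {A A' X X' : QC} [Nonempty A'.obj.idx] (φ : A ⊗ X ⟶ A' ⊗ X') :
    A.obj ⊗ (A'.obj ⊗ X.obj) ⟶ X'.obj :=
  (QC.measureAfter φ).hom ≫ (⟨compress fun x => (true, x), .compress _⟩ :
    CP.Hom ⟨Bool × X'.obj.idx⟩ X'.obj)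

/-- The insertion of `T` with a successful measurement, in `CP`, is the block of the insertion in
`QC` where the outcome is true. -/
lemma QC.tensorLin_insertAux_successAfter {A A' B B' X X' : QC} [Nonempty A'.obj.idx]
    (φ : A ⊗ X ⟶ A' ⊗ X') (T : B ⊗ A' ⟶ B' ⊗ A) :
    CP.tensorLin (insertAux (bellPair A' X).hom T.hom (successAfter φ)) =
      block (insertAux (bellPair A' X) T (measureAfter φ)) true true := rfl

/-- The case where `K` has an output system of positive dimension, so that Bell pairs exist on it. -/
lemma LocallyApplicable.app_eq_act_of_nonempty (S : LocallyApplicable K M) (hK : IsNormalConvex K)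
    (h : (β_ K.A K.A').hom ∈ K.ext.carrier K.A' K.A) [Nonempty K.A'.obj.idx] {X X' : QC}
    (φ : K.ext.carrier X X') : (S.app X X' φ).1.hom = act (S.toSupermap h) φ.1.hom := by
  have hcard : (1 : ℝ) ≤ Fintype.card K.A'.obj.idx := by
    exact_mod_cast Fintype.card_pos
  set t : ℝ := (Fintype.card K.A'.obj.idx : ℝ)⁻¹ ^ 2 with ht
  have h0 : 0 < t := by positivity
  have h1 : t ≤ 1 := pow_le_one₀ (by positivity) (inv_le_one_of_one_le₀ hcard)
  have hψ : QC.simulate φ.1 ∈ K.ext.carrier X (QC.sys Bool ⊗ X') := K.ext.insertAux_mem _ _ h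
  have hpost {Y Y' Z : QC} {χ : K.A ⊗ Y ⟶ K.A' ⊗ Y'} (hχ : χ ∈ K.ext.carrier Y Y') (g : Y' ⟶ Z) :
      QC.post χ g ∈ K.ext.carrier Y Z := K.ext.insertAux_mem _ _ hχ
  have key := S.tensorLin_add_eq hK (φ₁ := ⟨_, hψ⟩) (φ₂ := ⟨_, hpost φ.2 _⟩)
    (ψ₁ := ⟨_, hpost (hpost hψ _) _⟩) (ψ₂ := ⟨_, hpost φ.2 _⟩)
    (QC.tensorLin_add_eq_of_block h0.le h1 (QC.block_simulate_of_ne φ.1)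
      (QC.block_simulate_true φ.1))
  -- Only the blocks where the bit is true are compared: there, the failure branch of the
  -- measurement does not contribute.
  rw [QC.tensorLin_add_eq_iff] at key
  replace key := key true true
  rw [S.app_post _ (hpost hψ _), S.app_post _ φ.2, S.app_post _ φ.2, QC.block_post_adjoinCoin,
    QC.block_post_adjoinBit, QC.block_post_adjoinBit, QC.block_post_adjoinBit] at key
  simp only [single_apply, Bool.false_eq_true, and_self, if_false, zero_smul, add_zero, zero_add,
    if_true, one_smul, smul_zero] at key
  have hS : (S.app _ _ ⟨_, hψ⟩).1 = insertAux (QC.bellPair K.A' X) (S.app _ _ ⟨_, h⟩).1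
    (QC.measureAfter φ.1) := S.app_insertAux _ _ ⟨_, h⟩
  rw [hS, ← QC.tensorLin_insertAux_successAfter, ← act_unbraid (S.app _ _ ⟨_, h⟩).1.hom,
    ← act_insertAux] at key
  have hact := tensorLin_act_smul (S.toSupermap h) (φ := insertAux (QC.bellPair K.A' X).hom
    (β_ K.A.obj K.A'.obj).hom (QC.successAfter φ.1)) (ψ := φ.1.hom)
    (QC.block_simulate_true φ.1)
  refine CP.tensorLin_injective ?_
  refine smul_right_injective _ (Complex.ofReal_ne_zero.2 h0.ne') ?_
  exact key.symm.trans hact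

/-! ### Fullness and faithfulness -/

lemma IsNormalConvex.braiding_mem (hK : IsNormalConvex K) :
    (β_ K.A K.A').hom ∈ K.ext.carrier K.A' K.A :=
  hK.carrier_eq _ _ ▸ QC.braiding_mem_dExt hK.2.1

lemma QC.hom_ext_of_isEmpty {X Y : QC} [IsEmpty X.obj.idx] (φ ψ : X ⟶ Y) : φ = ψ :=
  QC.lin_injective (LinearMap.ext fun N => by rw [Subsingleton.elim N 0, map_zero, map_zero])

/-- If `K` has a zero-dimensional output system, then a locally-applicable transformation on it has
values with zero-dimensional input only: the transform of a channel with zero-dimensional input and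
output would be a channel to a zero-dimensional system. -/
lemma LocallyApplicable.isEmpty_of_isEmpty (S : LocallyApplicable K M) (hK : IsNormalConvex K)
    [IsEmpty K.A'.obj.idx] {X X' : QC} (φ : K.ext.carrier X X') :
    IsEmpty (M.A ⊗ X).obj.idx := by
  have : IsEmpty (K.A' ⊗ X').obj.idx :=
    inferInstanceAs (IsEmpty (K.A'.obj.idx × X'.obj.idx))
  have hAX : IsEmpty (K.A ⊗ X).obj.idx := QC.isEmpty_of_hom φ.1
  have hAX' : IsEmpty (K.A.obj.idx × X.obj.idx) := hAX
  rcases isEmpty_prod.1 hAX' with hA | hX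
  · -- As `A` is zero-dimensional, `X` may be nonzero; the zero map to a zero-dimensional output is
    -- then a channel with the same reductions as `φ`.
    let χ : K.A ⊗ X ⟶ K.A' ⊗ QC.sys Empty :=
      QC.mk 0 (fun c _ N _ => by
        have h : ampRight (0 : Matrix (K.A ⊗ X).obj.idx (K.A ⊗ X).obj.idx ℂ →ₗ[ℂ]
          Matrix (K.A' ⊗ QC.sys Empty).obj.idx (K.A' ⊗ QC.sys Empty).obj.idx ℂ) c N = 0 := rfl
        exact h ▸ PosSemidef.zero) fun N => by
          rw [Subsingleton.elim N 0, map_zero, trace_zero, trace_zero]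
    have hχ : χ ∈ K.ext.carrier X (QC.sys Empty) := by
      rw [hK.carrier_eq]
      intro ρ σ
      have hφ : φ.1 ∈ dExt K.K X X' := hK.carrier_eq _ _ ▸ φ.2
      rw [QC.hom_ext_of_isEmpty (plug ρ χ σ) (plug ρ φ.1 (discard X'))]
      exact hφ ρ _
    have : IsEmpty (M.A' ⊗ QC.sys Empty).obj.idx :=
      inferInstanceAs (IsEmpty (M.A'.obj.idx × Empty))
    exact QC.isEmpty_of_hom (S.app _ _ ⟨χ, hχ⟩).1
  · exact inferInstanceAs (IsEmpty (M.A.obj.idx × X.obj.idx))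

lemma LocallyApplicable.app_eq_act (S : LocallyApplicable K M) (hK : IsNormalConvex K)
    {X X' : QC} (φ : K.ext.carrier X X') :
    (S.app X X' φ).1.hom = act (S.toSupermap hK.braiding_mem) φ.1.hom := by
  rcases isEmpty_or_nonempty K.A'.obj.idx with h | h
  · have : IsEmpty (M.A.obj ⊗ X.obj).idx := S.isEmpty_of_isEmpty hK φ
    refine CP.Hom.ext (LinearMap.ext fun N => ?_)
    rw [Subsingleton.elim (α := Matrix (M.A.obj ⊗ X.obj).idx (M.A.obj ⊗ X.obj).idx ℂ) N 0]
    exact (map_zero _).trans (map_zero _).symm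
  · exact S.app_eq_act_of_nonempty hK _ φ

instance : FCPcon.Full where
  map_surjective {K M} T := by
    let S : LocallyApplicable K.obj.of M.obj.of := T.hom
    have hS {X X' : QC} (φ : K.obj.of.ext.carrier X X') :=
      S.app_eq_act K.property φ
    refine ⟨ObjectProperty.homMk ⟨S.toSupermap (IsNormalConvex.braiding_mem K.property), ?_⟩, ?_⟩
    · intro X X' φ hφ
      rw [← hS ⟨φ, hφ⟩]
      exact ⟨(S.app X X' ⟨φ, hφ⟩).1.property, (S.app X X' ⟨φ, hφ⟩).2⟩
    · refine InducedCategory.Hom.ext (LocallyApplicable.ext ?_)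
      funext X X' φ
      exact Subtype.ext (WideSubcategory.hom_ext _ (hS φ).symm)

instance : FCPcon.Faithful where
  map_injective {K M} S T h := by
    refine InducedCategory.Hom.ext (Supermap.ext (act_braiding_injective ?_))
    have h' := congrArg (fun U : FCPcon.obj K ⟶ FCPcon.obj M => (LocallyApplicable.app
      (K := K.obj.of) (M := M.obj.of) U.hom _ _
      ⟨_, IsNormalConvex.braiding_mem K.property⟩).1.hom) h
    exact h'

lemma FCPcon_obj_surjective : Function.Surjective FCPcon.obj :=
  fun L => ⟨⟨⟨L.obj.of⟩, L.property⟩, rfl⟩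

end HigherOrder

theorem mainTheorem3 :
    (∀ (K M : HigherOrder.QS) (S : K ⟶ M) (X X' : HigherOrder.QC)
        (φ : K.of.ext.carrier X X'),
      ((HigherOrder.FCP.map S).app X X' φ).1.hom = HigherOrder.act S.hom φ.1.hom) ∧
    HigherOrder.FCPcon.IsEquivalence ∧
    Function.Surjective HigherOrder.FCPcon.obj ∧
    HigherOrder.FCPcon.Full ∧
    HigherOrder.FCPcon.Faithful := by
  refine ⟨fun _ _ _ _ _ _ => rfl, ?_, HigherOrder.FCPcon_obj_surjective, inferInstance,
    inferInstance⟩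
  have : HigherOrder.FCPcon.EssSurj := ⟨fun L => by
    obtain ⟨K, rfl⟩ := HigherOrder.FCPcon_obj_surjective L
    exact ⟨K, ⟨Iso.refl _⟩⟩⟩
  exact {}
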